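/- Let $m \ge n \ge 3$. The squares of the $m \times n$ projective checkerboard are the pairs $(p,q)$ of integers with $0 \le p \le m-1$ and $0 \le q \le n-1$. It is the digraph on these squares with a directed edge from each square $\sigma$ to $\sigma E$ and to $\sigma N$, where $$(p,q)E = \begin{cases} (p+1,q) & \text{if } p < m-1,\\ (0,n-1-q) & \text{if } p = m-1,\end{cases} \qquad (p,q)N = \begin{cases} (p,q+1) & \text{if } q < n-1,\\ (m-1-p,0) & \text{if } q = n-1.\end{cases}$$ A hamiltonian path is a directed path that visits every square exactly once; its initial square is the first square it visits. Then there is a hamiltonian path whose initial square is $(p,q)$ if and only if at least one of the following holds: 1. $p = 0$ and $\lfloor (n-1)/2 \rfloor \le q \le n-1$; 2. $\lfloor (n-1)/2 \rfloor \le p \le m-1$ and $q = 0$; 3. $\lceil m/2 \rceil \le p \le m-1$ and $q = \lfloor n/2 \rfloor$; 4. $0 \le p \le \lfloor n/2 \rfloor$ and $q = \lfloor (n-1)/2 \rfloor$; 5. $\lfloor m/2 \rfloor \le p \le m - \lceil n/2 \rceil$ and $\lfloor n/2 \rfloor + 1 \le q \le n-1$; 6. $\lfloor (n-1)/2 \rfloor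 \le p \le \lfloor (m-1)/2 \rfloor$ and $0 \le q \le \lfloor n/2 \rfloor$. -/

import Mathlib

namespace ProjectiveCheckerboard

/-- The squares of an `m × n` checkerboard: pairs `(p, q)` with `0 ≤ p ≤ m - 1` and
`0 ≤ q ≤ n - 1`. -/
abbrev Square (m n : ℕ) : Type := Fin m × Fin n

/-- One step east: `(p, q) ↦ (p + 1, q)` if `p < m - 1`, and `(m - 1, q) ↦ (0, n - 1 - q)`.
Note that `Fin.rev q` is `n - 1 - q`. -/
def east {m n : ℕ} (σ : Square m n) : Square m n :=
  if h : (σ.1 : ℕ) + 1 < m then (⟨(σ.1 : ℕ) + 1, h⟩, σ.2) else (⟨0, σ.1.pos⟩, Fin.rev σ.2)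

/-- One step north: `(p, q) ↦ (p, q + 1)` if `q < n - 1`, and `(p, n - 1) ↦ (m - 1 - p, 0)`. -/
def north {m n : ℕ} (σ : Square m n) : Square m n :=
  if h : (σ.2 : ℕ) + 1 < n then (σ.1, ⟨(σ.2 : ℕ) + 1, h⟩) else (Fin.rev σ.1, ⟨0, σ.2.pos⟩)

/-- The `m × n` projective checkerboard: there is a directed edge from each square to the square
east of it and to the square north of it. -/
def board (m n : ℕ) : Digraph (Square m n) where
  Adj σ τ := τ = east σ ∨ τ = north σ

/-- A hamiltonian path in a digraph, given as the list of its vertices in order: successive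
vertices are joined by directed edges, no vertex is repeated, and every vertex is visited. -/
structure IsHamiltonianPath {V : Type*} (G : Digraph V) (l : List V) : Prop where
  isChain : l.IsChain G.Adj
  nodup : l.Nodup
  mem : ∀ v : V, v ∈ l

end ProjectiveCheckerboard

/-! Give a square the direction in which a path leaves it. A square entered from neither neighbour
must be the initial one, and no square is left twice, so directions propagate along the diagonals p
+ q = i. Wrapping at the edge continues the diagonal i into the diagonal m + n - 3 - i. Hence every
such pair of diagonals, except the one containing the terminal square, travels entirely east or
entirely north (`CoveringRoute.holdsOn`). The exceptional pair, a and b = m + n - 3 - a, is the one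
for which the initial square lies on the diagonal a + 1 or b + 1.

All the other pairs are summarised by two maps. The squares beyond b return to the diagonal a by the
half-turn, whatever the directions chosen (`OuterFlow`). The squares of the diagonal a + 1 reach b
by a translation (e, s) where this fits, and by the half-turn otherwise (`InnerFlow`); each east
pair adds 2 to e, each north pair adds 2 to s, and a self-paired middle diagonal adds 1.

Necessity: in terms of rows, one circuit a, a + 1, b, b + 1, a is one of two reflections whose
centres differ by a half, and the row of the initial square decides which of them applies. A path
has no cycle, so two rows may not be exchanged; this leaves at most two values for the row of the
initial square. The absence of cycles also bounds e and s (`CoveringRoute.east_bound`,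
`CoveringRoute.north_bound`), and the listed regions result.

Sufficiency: explicit direction patterns realise each region. Sending the terminal square to the
initial one turns such a pattern into a permutation, so it suffices that every square reaches the
terminal one. This holds because the two reflections compose to a shift by one row. -/

namespace ProjectiveCheckerboard

/-! ### Reachability relations and paired diagonals. -/

/-- `Route m n E N Q` says that, on the `m × n` projective checkerboard with integer coordinates,
the preorder `Q` contains the step east from each square satisfying `E` and the step north from
each square satisfying `N`. -/
structure Route (m n : ℤ) (E N : ℤ → ℤ → Prop) (Q : ℤ → ℤ → ℤ → ℤ → Prop) : Prop where
  refl : ∀ {p q p' q' : ℤ}, p = p' → q = q' → Q p q p' q'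
  trans : ∀ {p q p' q' p'' q'' : ℤ}, Q p q p' q' → Q p' q' p'' q'' → Q p q p'' q''
  east : ∀ {p q p' q' : ℤ}, E p q → 0 ≤ p → p + 1 < m → 0 ≤ q → q < n → p' = p + 1 → q' = q →
    Q p q p' q'
  eastWrap : ∀ {p q p' q' : ℤ}, E p q → p + 1 = m → 0 ≤ q → q < n → p' = 0 → q' = n - 1 - q →
    Q p q p' q'
  north : ∀ {p q p' q' : ℤ}, N p q → 0 ≤ p → p < m → 0 ≤ q → q + 1 < n → p' = p → q' = q + 1 →
    Q p q p' q'
  northWrap : ∀ {p q p' q' : ℤ}, N p q → 0 ≤ p → p < m → q + 1 = n → p' = m - 1 - p → q' = 0 →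
    Q p q p' q'

/-- The property `E` holds on the `i`-th diagonal and on the diagonal paired with it. -/
def HoldsOn (m n : ℤ) (E : ℤ → ℤ → Prop) (i : ℤ) : Prop :=
  ∀ p q, 0 ≤ p → p < m → 0 ≤ q → q < n → (p + q = i ∨ p + q = m + n - 3 - i) → E p q

/-- Squares just after the diagonal paired with `a` are carried to the diagonal `a` by the
half-turn of the board. -/
def OuterFlow (m n : ℤ) (Q : ℤ → ℤ → ℤ → ℤ → Prop) (a : ℤ) : Prop :=
  ∀ p q p' q', 0 ≤ p → p < m → 0 ≤ q → q < n → p + q = m + n - 2 - a → p' = m - 1 - p →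
    q' = n - 1 - q → Q p q p' q'

/-- Squares just after the diagonal `i` are carried to the diagonal paired with `i`, by the
translation by `(e, s)` where this stays on the board, and by the half-turn elsewhere. -/
def InnerFlow (m n : ℤ) (Q : ℤ → ℤ → ℤ → ℤ → Prop) (i e s : ℤ) : Prop :=
  ∀ p q p' q', 0 ≤ p → p < m → 0 ≤ q → q < n → p + q = i + 1 →
    (p + e < m ∧ q + s < n ∧ p' = p + e ∧ q' = q + s ∨
      (m ≤ p + e ∨ n ≤ q + s) ∧ p' = m - 1 - p ∧ q' = n - 1 - q) → Q p q p' q'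

/-- Every square strictly after the diagonal `i` and not after its paired diagonal is carried to
the latter. -/
def ExitFlow (m n : ℤ) (Q : ℤ → ℤ → ℤ → ℤ → Prop) (i : ℤ) : Prop :=
  ∀ p q, 0 ≤ p → p < m → 0 ≤ q → q < n → i < p + q → p + q ≤ m + n - 3 - i →
    ∃ p' q', 0 ≤ p' ∧ p' < m ∧ 0 ≤ q' ∧ q' < n ∧ p' + q' = m + n - 3 - i ∧ Q p q p' q'

/-! ### Symmetry exchanging the two coordinates. -/

section Transpose

variable {m n : ℤ} {E N : ℤ → ℤ → Prop} {Q : ℤ → ℤ → ℤ → ℤ → Prop} {i e s : ℤ}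

theorem Route.transpose (h : Route m n E N Q) :
    Route n m (fun p q => N q p) (fun p q => E q p) (fun p q p' q' => Q q p q' p') where
  refl h₁ h₂ := h.refl h₂ h₁
  trans h₁ h₂ := h.trans h₁ h₂
  east h₁ h₂ h₃ h₄ h₅ h₆ h₇ := h.north h₁ h₄ h₅ h₂ h₃ h₇ h₆
  eastWrap h₁ h₂ h₃ h₄ h₅ h₆ := h.northWrap h₁ h₃ h₄ h₂ h₆ h₅
  north h₁ h₂ h₃ h₄ h₅ h₆ h₇ := h.east h₁ h₄ h₅ h₂ h₃ h₇ h₆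
  northWrap h₁ h₂ h₃ h₄ h₅ h₆ := h.eastWrap h₁ h₄ h₂ h₃ h₆ h₅

theorem HoldsOn.transpose (h : HoldsOn m n E i) : HoldsOn n m (fun p q => E q p) i :=
  fun p q h₁ h₂ h₃ h₄ h₅ => h q p h₃ h₄ h₁ h₂ (by omega)

theorem OuterFlow.transpose (h : OuterFlow m n Q i) :
    OuterFlow n m (fun p q p' q' => Q q p q' p') i :=
  fun p q p' q' h₁ h₂ h₃ h₄ h₅ h₆ h₇ => h q p q' p' h₃ h₄ h₁ h₂ (by omega) h₇ h₆

theorem InnerFlow.transpose (h : InnerFlow m n Q i e s) :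
    InnerFlow n m (fun p q p' q' => Q q p q' p') i s e :=
  fun p q p' q' h₁ h₂ h₃ h₄ h₅ h₆ => h q p q' p' h₃ h₄ h₁ h₂ (by omega) (by omega)

theorem ExitFlow.transpose (h : ExitFlow m n Q i) :
    ExitFlow n m (fun p q p' q' => Q q p q' p') i := by
  intro p q h₁ h₂ h₃ h₄ h₅ h₆
  obtain ⟨p', q', g₁, g₂, g₃, g₄, g₅, g₆⟩ := h q p h₃ h₄ h₁ h₂ (by omega) (by omega)
  exact ⟨q', p', g₃, g₄, g₁, g₂, by omega, g₆⟩

end Transpose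

/-! ### How a pair of constant direction changes the outer and inner flows. -/

section Flow

variable {m n : ℤ} {E N : ℤ → ℤ → Prop} {Q : ℤ → ℤ → ℤ → ℤ → Prop} {i e s : ℤ}

/-- One step reaches the next diagonal outwards, the known half-turn brings the path back, and a
second step in the same direction compensates the first. A square of the last column wraps directly
to its half-turn image. -/
theorem OuterFlow.east (h : Route m n E N Q) (hE : HoldsOn m n E i) (hi : OuterFlow m n Q i) :
    OuterFlow m n Q (i + 1) := by
  intro p q p' q' h₁ h₂ h₃ h₄ h₅ h₆ h₇
  have hpq := hE p q h₁ h₂ h₃ h₄ (by omega)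
  by_cases hp : p + 1 = m
  · exact h.eastWrap hpq hp h₃ h₄ (by omega) h₇
  · refine h.trans (h.east hpq h₁ (by omega) h₃ h₄ rfl rfl) ?_
    refine h.trans (hi (p + 1) q (m - 2 - p) (n - 1 - q) ?_ ?_ ?_ ?_ ?_ ?_ ?_) ?_ <;> try omega
    refine h.east (hE _ _ ?_ ?_ ?_ ?_ ?_) ?_ ?_ ?_ ?_ ?_ ?_ <;> omega

theorem OuterFlow.north (h : Route m n E N Q) (hN : HoldsOn m n N i) (hi : OuterFlow m n Q i) :
    OuterFlow m n Q (i + 1) :=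
  (OuterFlow.east h.transpose hN.transpose hi.transpose).transpose

/-- The induction starts at the corner (m - 1, n - 1), which is the half-turn image of (0, 0); each
later pair keeps the half-turn in either direction. -/
theorem OuterFlow.of_corner (h : Route m n E N Q) (h0 : Q (m - 1) (n - 1) 0 0) (a : ℕ)
    (hc : ∀ i : ℤ, 0 ≤ i → i < a → HoldsOn m n E i ∨ HoldsOn m n N i) :
    OuterFlow m n Q a := by
  induction a with
  | zero =>
    intro p q p' q' h₁ h₂ h₃ h₄ h₅ h₆ h₇
    obtain rfl : p = m - 1 := by push_cast at h₅; omega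
    obtain rfl : q = n - 1 := by push_cast at h₅; omega
    obtain rfl : p' = 0 := by omega
    obtain rfl : q' = 0 := by omega
    exact h0
  | succ a ih =>
    have ih := ih fun i h₁ h₂ => hc i h₁ (by push_cast; omega)
    push_cast
    rcases hc a (by omega) (by push_cast; omega) with hE | hN
    · exact ih.east h hE
    · exact ih.north h hN

/-- The translation gains one step before and one step after the old inner region. Where the
enlarged translation leaves the board, the path wraps or was already half-turned, and the result is
again a half-turn. -/
theorem InnerFlow.east (h : Route m n E N Q) (hE : HoldsOn m n E i) (he : 0 ≤ e) (hs : 0 ≤ s)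
    (hes : e + s = m + n - 4 - 2 * i) (hi : InnerFlow m n Q i e s) :
    InnerFlow m n Q (i - 1) (e + 2) s := by
  intro p q p' q' h₁ h₂ h₃ h₄ h₅ h₆
  have hpq := hE p q h₁ h₂ h₃ h₄ (by omega)
  by_cases hp : p + 1 = m
  · exact h.eastWrap hpq hp h₃ h₄ (by omega) (by omega)
  refine h.trans (h.east hpq h₁ (by omega) h₃ h₄ rfl rfl) ?_
  by_cases hfit : p + 1 + e < m ∧ q + s < n
  · refine h.trans (hi (p + 1) q (p + 1 + e) (q + s) ?_ ?_ ?_ ?_ ?_ ?_) ?_ <;> try omega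
    have hB : E (p + 1 + e) (q + s) := by apply hE <;> omega
    -- In the last column the second east step wraps back to the diagonal i + 1, so the inner region
    -- is crossed a second time.
    by_cases hw : p + 2 + e = m
    · refine h.trans (h.eastWrap hB (by omega) (by omega) (by omega) rfl rfl) ?_
      refine h.trans (hi _ _ e (n - 1 - q) ?_ ?_ ?_ ?_ ?_ ?_) ?_ <;> try omega
      refine h.east (hE _ _ ?_ ?_ ?_ ?_ ?_) ?_ ?_ ?_ ?_ ?_ ?_ <;> omega
    · refine h.east hB ?_ ?_ ?_ ?_ ?_ ?_ <;> omega
  · refine h.trans (hi (p + 1) q (m - 2 - p) (n - 1 - q) ?_ ?_ ?_ ?_ ?_ ?_) ?_ <;> try omega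
    refine h.east (hE _ _ ?_ ?_ ?_ ?_ ?_) ?_ ?_ ?_ ?_ ?_ ?_ <;> omega

theorem InnerFlow.north (h : Route m n E N Q) (hN : HoldsOn m n N i) (he : 0 ≤ e) (hs : 0 ≤ s)
    (hes : e + s = m + n - 4 - 2 * i) (hi : InnerFlow m n Q i e s) :
    InnerFlow m n Q (i - 1) e (s + 2) :=
  (InnerFlow.east h.transpose hN.transpose hs he (by omega) hi.transpose).transpose

theorem InnerFlow.of_adjacent (h : Route m n E N Q) (hi : 2 * i = m + n - 4) :
    InnerFlow m n Q i 0 0 := by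
  intro p q p' q' h₁ h₂ h₃ h₄ h₅ h₆
  exact h.refl (by omega) (by omega)

theorem InnerFlow.of_east (h : Route m n E N Q) (hi : 2 * i = m + n - 5)
    (hE : HoldsOn m n E (i + 1)) : InnerFlow m n Q i 1 0 := by
  intro p q p' q' h₁ h₂ h₃ h₄ h₅ h₆
  have hpq := hE p q h₁ h₂ h₃ h₄ (by omega)
  by_cases hp : p + 1 = m
  · exact h.eastWrap hpq hp h₃ h₄ (by omega) (by omega)
  · exact h.east hpq h₁ (by omega) h₃ h₄ (by omega) (by omega)

theorem InnerFlow.of_north (h : Route m n E N Q) (hi : 2 * i = m + n - 5)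
    (hN : HoldsOn m n N (i + 1)) : InnerFlow m n Q i 0 1 :=
  (InnerFlow.of_east h.transpose (by omega) hN.transpose).transpose

theorem ExitFlow.of_adjacent (h : Route m n E N Q) (hi : 2 * i = m + n - 4) :
    ExitFlow m n Q i := by
  intro p q h₁ h₂ h₃ h₄ h₅ h₆
  exact ⟨p, q, h₁, h₂, h₃, h₄, by omega, h.refl rfl rfl⟩

theorem ExitFlow.of_east (h : Route m n E N Q) (hi : 2 * i = m + n - 5)
    (hE : HoldsOn m n E (i + 1)) : ExitFlow m n Q i := by
  intro p q h₁ h₂ h₃ h₄ h₅ h₆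
  by_cases hq : p + q = m + n - 3 - i
  · exact ⟨p, q, h₁, h₂, h₃, h₄, hq, h.refl rfl rfl⟩
  have hpq := hE p q h₁ h₂ h₃ h₄ (by omega)
  by_cases hp : p + 1 = m
  · exact ⟨0, n - 1 - q, by omega, by omega, by omega, by omega, by omega,
      h.eastWrap hpq hp h₃ h₄ rfl rfl⟩
  · exact ⟨p + 1, q, by omega, by omega, by omega, by omega, by omega,
      h.east hpq h₁ (by omega) h₃ h₄ rfl rfl⟩

theorem ExitFlow.of_north (h : Route m n E N Q) (hi : 2 * i = m + n - 5)
    (hN : HoldsOn m n N (i + 1)) : ExitFlow m n Q i :=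
  (ExitFlow.of_east h.transpose (by omega) hN.transpose).transpose

/-- A square can fail to leave only by wrapping from (m - 1, n - 2 - i) back to (0, i + 1). The
condition `hfit` makes the translation of (0, i + 1) fit with room for one more east step, so the
second crossing leaves at (e + 1, i + 1 + s). -/
theorem ExitFlow.east (h : Route m n E N Q) (hE : HoldsOn m n E i) (hi0 : 0 ≤ i)
    (he : 0 ≤ e) (hs : 0 ≤ s)
    (hes : e + s = m + n - 4 - 2 * i) (hi : InnerFlow m n Q i e s) (hx : ExitFlow m n Q i)
    (hfit : i + 2 ≤ n → i + 2 + s ≤ n ∧ e + 2 ≤ m) :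
    ExitFlow m n Q (i - 1) := by
  have main : ∀ p q, 0 ≤ p → p < m → 0 ≤ q → q < n → i < p + q → p + q ≤ m + n - 3 - i →
      ∃ p' q', 0 ≤ p' ∧ p' < m ∧ 0 ≤ q' ∧ q' < n ∧ p' + q' = m + n - 3 - (i - 1) ∧ Q p q p' q' := by
    intro p q h₁ h₂ h₃ h₄ h₅ h₆
    obtain ⟨p', q', g₁, g₂, g₃, g₄, g₅, g₆⟩ := hx p q h₁ h₂ h₃ h₄ h₅ h₆
    have hB := hE p' q' g₁ g₂ g₃ g₄ (by omega)
    by_cases hp : p' + 1 = m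
    · refine ⟨e + 1, i + 1 + s, by omega, by omega, by omega, by omega, by omega, h.trans g₆ ?_⟩
      refine h.trans (h.eastWrap hB hp g₃ g₄ rfl rfl) ?_
      refine h.trans (hi _ _ e (i + 1 + s) ?_ ?_ ?_ ?_ ?_ ?_) ?_ <;> try omega
      refine h.east (hE _ _ ?_ ?_ ?_ ?_ ?_) ?_ ?_ ?_ ?_ ?_ ?_ <;> omega
    · exact ⟨p' + 1, q', by omega, by omega, by omega, by omega, by omega, h.trans g₆
        (h.east hB g₁ (by omega) g₃ g₄ rfl rfl)⟩
  intro p q h₁ h₂ h₃ h₄ h₅ h₆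
  by_cases hq : p + q = m + n - 3 - (i - 1)
  · exact ⟨p, q, h₁, h₂, h₃, h₄, hq, h.refl rfl rfl⟩
  by_cases hq' : i < p + q
  · exact main p q h₁ h₂ h₃ h₄ hq' (by omega)
  have hpq := hE p q h₁ h₂ h₃ h₄ (by omega)
  by_cases hp : p + 1 = m
  · exact ⟨0, n - 1 - q, by omega, by omega, by omega, by omega, by omega,
      h.eastWrap hpq hp h₃ h₄ rfl rfl⟩
  · obtain ⟨p', q', g₁, g₂, g₃, g₄, g₅, g₆⟩ := main (p + 1) q (by omega) (by omega) h₃ h₄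
      (by omega) (by omega)
    exact ⟨p', q', g₁, g₂, g₃, g₄, g₅, h.trans (h.east hpq h₁ (by omega) h₃ h₄ rfl rfl) g₆⟩

theorem ExitFlow.north (h : Route m n E N Q) (hN : HoldsOn m n N i) (hi0 : 0 ≤ i)
    (he : 0 ≤ e) (hs : 0 ≤ s)
    (hes : e + s = m + n - 4 - 2 * i) (hi : InnerFlow m n Q i e s) (hx : ExitFlow m n Q i)
    (hfit : i + 2 ≤ m → i + 2 + e ≤ m ∧ s + 2 ≤ n) :
    ExitFlow m n Q (i - 1) :=
  (ExitFlow.east h.transpose hN.transpose hi0 hs he (by omega) hi.transpose hx.transpose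
    hfit).transpose

end Flow

/-! ### Constraints that a hamiltonian path puts on the diagonals. -/

/-- A `Route` whose preorder is antisymmetric, in which every square other than the initial
square `(x, y)` is entered from the west or from the south, and in which no square other than the
corner `(m - 1, n - 1)` is left in both directions. -/
structure CoveringRoute (m n x y : ℤ) (E N : ℤ → ℤ → Prop) (Q : ℤ → ℤ → ℤ → ℤ → Prop) : Prop
    extends Route m n E N Q where
  antisymm : ∀ {p q p' q' : ℤ}, Q p q p' q' → Q p' q' p q → p = p' ∧ q = q'
  excl : ∀ {p q : ℤ}, E p q → N p q → p + 1 = m ∧ q + 1 = n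
  cover : ∀ {p q : ℤ}, 0 ≤ p → p + 1 < m → 0 ≤ q → q + 1 < n → (x = p + 1 → y ≠ q + 1) →
    E p (q + 1) ∨ N (p + 1) q
  coverLeft : ∀ {q : ℤ}, 0 ≤ q → q + 1 < n → (x = 0 → y ≠ q + 1) →
    E (m - 1) (n - 2 - q) ∨ N 0 q
  coverBottom : ∀ {p : ℤ}, 0 ≤ p → p + 1 < m → (x = p + 1 → y ≠ 0) →
    E p 0 ∨ N (m - 2 - p) (n - 1)
  coverCorner : (x = 0 → y ≠ 0) → E (m - 1) (n - 1) ∨ N (m - 1) (n - 1)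

section CoveringRoute

variable {m n x y : ℤ} {E N : ℤ → ℤ → Prop} {Q : ℤ → ℤ → ℤ → ℤ → Prop}

theorem CoveringRoute.transpose (h : CoveringRoute m n x y E N Q) :
    CoveringRoute n m y x (fun p q => N q p) (fun p q => E q p)
      (fun p q p' q' => Q q p q' p') where
  toRoute := h.toRoute.transpose
  antisymm h₁ h₂ := (h.antisymm h₁ h₂).symm
  excl h₁ h₂ := (h.excl h₂ h₁).symm
  cover h₁ h₂ h₃ h₄ h₅ := (h.cover h₃ h₄ h₁ h₂ (by omega)).symm
  coverLeft h₁ h₂ h₃ := (h.coverBottom h₁ h₂ (by omega)).symm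
  coverBottom h₁ h₂ h₃ := (h.coverLeft h₁ h₂ (by omega)).symm
  coverCorner h₁ := (h.coverCorner (by omega)).symm

/-- If a square does not travel north, then the squares above it on its diagonal travel east, up
to the initial square. -/
theorem CoveringRoute.east_above (h : CoveringRoute m n x y E N Q) {p q : ℤ} (hN : ¬ N p q)
    (hp : p < m) (hq : 0 ≤ q) {p' q' : ℤ} (hsum : p' + q' = p + q) (hlt : q < q') (hp' : 0 ≤ p')
    (hq' : q' < n) (hι : x + y = p + q + 1 → q < y → q' < y) : E p' q' := by
  obtain ⟨k, rfl⟩ : ∃ k : ℕ, q' = q + 1 + k := ⟨(q' - q - 1).toNat, by omega⟩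
  induction k generalizing p' with
  | zero =>
    obtain rfl : p = p' + 1 := by push_cast at hsum; omega
    push_cast at *
    rw [add_zero]
    exact (h.cover hp' hp hq (by omega) (by omega)).resolve_right hN
  | succ k ih =>
    have h1 : E (p' + 1) (q + 1 + k) := by
      apply ih <;> push_cast at * <;> omega
    have h2 : ¬ N (p' + 1) (q + 1 + k) := fun h2 => by
      have := h.excl h1 h2
      push_cast at *; omega
    have h3 := (h.cover (p := p') (q := q + 1 + k) hp' (by push_cast at *; omega) (by omega)
      (by push_cast at *; omega) (by push_cast at *; omega)).resolve_right h2
    convert h3 using 1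
    push_cast; ring

theorem CoveringRoute.north_below (h : CoveringRoute m n x y E N Q) {p q : ℤ} (hE : ¬ E p q)
    (hq : q < n) (hp : 0 ≤ p) {p' q' : ℤ} (hsum : p' + q' = p + q) (hlt : q' < q) (hq' : 0 ≤ q')
    (hp' : p' < m) (hι : x + y = p + q + 1 → y ≤ q → y ≤ q') : N p' q' :=
  h.transpose.east_above hE hq hp (by omega) (by omega) hq' hp' (by omega)

/-- If a square of the diagonal `j` does not travel north, and neither the diagonal `j` nor its
paired diagonal leads to the initial square, then the paired diagonal travels east. -/
theorem CoveringRoute.east_of_not_north (h : CoveringRoute m n x y E N Q) {j p q : ℤ}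
    (hN : ¬ N p q) (hp0 : 0 ≤ p) (hp : p < m) (hq0 : 0 ≤ q) (hq : q < n) (hj : p + q = j)
    (hj' : j < m + n - 2) (hι : x + y ≠ j + 1) (hι' : x + y ≠ m + n - 2 - j) {p' q' : ℤ}
    (hp'0 : 0 ≤ p') (hp' : p' < m) (hq'0 : 0 ≤ q') (hq' : q' < n)
    (hsum : p' + q' = m + n - 3 - j) : E p' q' := by
  -- Not travelling north spreads up to the top end of the diagonal j; the square after that end
  -- must then be entered by an east step from the lowest square of the paired diagonal, whence east
  -- spreads upwards there too.
  have top : ∀ r t, r + t = j → 0 ≤ r → q ≤ t → t < n → ¬ N r t := by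
    intro r t h₁ h₂ h₃ h₄
    rcases h₃.eq_or_lt with h₅ | h₅
    · obtain rfl : r = p := by omega
      rwa [← h₅]
    · intro h₆
      have := h.excl (h.east_above hN hp hq0 (p' := r) (q' := t) (by omega) h₅ h₂ h₄ (by omega)) h₆
      omega
  have above : ∀ r t, r + t = m + n - 3 - j → 0 ≤ r → r < m → 0 ≤ t → t < n → E r t →
      t ≤ q' → E p' q' := by
    intro r t h₁ h₂ h₃ h₄ h₅ h₆ h₇
    rcases h₇.eq_or_lt with h₈ | h₈
    · obtain rfl : r = p' := by omega
      rwa [← h₈]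
    · exact h.east_above (fun h₉ => by have := h.excl h₆ h₉; omega) h₃ h₄ (by omega) h₈ hp'0 hq'
        (by omega)
  rcases le_or_gt (n - 1) j with hn | hn
  · refine above (m + n - 3 - j) 0 (by omega) (by omega) (by omega) le_rfl (by omega) ?_ hq'0
    refine (h.coverBottom (by omega) (by omega) (by omega)).resolve_right ?_
    apply top <;> omega
  · refine above (m - 1) (n - 2 - j) (by omega) (by omega) (by omega) (by omega) (by omega) ?_
      (by omega)
    refine (h.coverLeft (by omega) (by omega) (by omega)).resolve_right ?_
    apply top <;> omega

/-- One square that does not travel north makes the paired diagonal travel east; any square of the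
latter then forces the original diagonal to travel east as well. -/
theorem CoveringRoute.holdsOn (h : CoveringRoute m n x y E N Q) {i : ℤ} (hi : 0 ≤ i)
    (hi' : i ≤ m + n - 3 - i) (hι : x + y ≠ i + 1) (hι' : x + y ≠ m + n - 2 - i) (hm : 2 ≤ m)
    (hn : 2 ≤ n) : HoldsOn m n E i ∨ HoldsOn m n N i := by
  by_cases hN : HoldsOn m n N i
  · exact Or.inr hN
  left
  obtain ⟨p, q, h₁, h₂, h₃, h₄, h₅, h₆⟩ : ∃ p q, 0 ≤ p ∧ p < m ∧ 0 ≤ q ∧ q < n ∧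
      (p + q = i ∨ p + q = m + n - 3 - i) ∧ ¬ N p q := by
    by_contra hc
    push Not at hc
    exact hN fun p q h₁ h₂ h₃ h₄ h₅ => hc p q h₁ h₂ h₃ h₄ h₅
  have key : ∀ p' q', 0 ≤ p' → p' < m → 0 ≤ q' → q' < n → p' + q' = m + n - 3 - (p + q) →
      E p' q' := fun p' q' g₁ g₂ g₃ g₄ g₅ =>
    h.east_of_not_north h₆ h₁ h₂ h₃ h₄ rfl (by omega) (by omega) (by omega) g₁ g₂ g₃ g₄ g₅
  obtain ⟨r, t, k₁, k₂, k₃, k₄, k₅⟩ : ∃ r t, 0 ≤ r ∧ r < m ∧ 0 ≤ t ∧ t < n ∧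
      r + t = m + n - 3 - (p + q) := by
    rcases le_or_gt (p + q) (n - 1) with hc | hc
    · rcases le_or_gt (n - 1) (p + q) with hd | hd
      · exact ⟨m + n - 3 - (p + q), 0, by omega, by omega, by omega, by omega, by omega⟩
      · exact ⟨m - 1, n - 2 - (p + q), by omega, by omega, by omega, by omega, by omega⟩
    · exact ⟨m + n - 3 - (p + q), 0, by omega, by omega, by omega, by omega, by omega⟩
  have hrt : ¬ N r t := fun h₇ => by have := h.excl (key r t k₁ k₂ k₃ k₄ k₅) h₇; omega
  intro p' q' g₁ g₂ g₃ g₄ g₅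
  by_cases hs : p' + q' = m + n - 3 - (p + q)
  · exact key p' q' g₁ g₂ g₃ g₄ hs
  · exact h.east_of_not_north hrt k₁ k₂ k₃ k₄ rfl (by omega) (by omega) (by omega) g₁ g₂ g₃ g₄
      (by omega)

/-- A nonterminal inner diagonal that travels east is subject to these bounds. -/
theorem CoveringRoute.east_bound (h : CoveringRoute m n x y E N Q) {i e s : ℤ}
    (hi0 : 0 ≤ i) (hin : i + 2 ≤ n) (hE : HoldsOn m n E i) (he : 0 ≤ e) (hs : 0 ≤ s)
    (hes : e + s = m + n - 4 - 2 * i) (hi : InnerFlow m n Q i e s) (hm : 2 ≤ m) :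
    i + 2 + s ≤ n ∧ e + 2 ≤ m := by
  by_contra hc
  -- The wrap from the last column is undone by the half-turn if the translation does not fit, which
  -- gives a cycle.
  have h1 : Q (m - 1) (n - 2 - i) 0 (i + 1) := by
    refine h.eastWrap (hE _ _ ?_ ?_ ?_ ?_ ?_) ?_ ?_ ?_ ?_ ?_ <;> omega
  have h2 : Q 0 (i + 1) (m - 1) (n - 2 - i) := by
    apply hi <;> omega
  have := h.antisymm h1 h2
  omega

theorem CoveringRoute.north_bound (h : CoveringRoute m n x y E N Q) {i e s : ℤ}
    (hi0 : 0 ≤ i) (him : i + 2 ≤ m) (hN : HoldsOn m n N i) (he : 0 ≤ e) (hs : 0 ≤ s)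
    (hes : e + s = m + n - 4 - 2 * i) (hi : InnerFlow m n Q i e s) (hn : 2 ≤ n) :
    i + 2 + e ≤ m ∧ s + 2 ≤ n :=
  h.transpose.east_bound hi0 him hN.transpose hs he (by omega) hi.transpose hn

end CoveringRoute

/-! ### The row of the initial square, from the absence of cycles. -/

section Terminal

variable {m n x y : ℤ} {E N : ℤ → ℤ → Prop} {Q : ℤ → ℤ → ℤ → ℤ → Prop} {a e s η : ℤ}

/-- The row of an initial square just after the upper terminal diagonal. -/
theorem CoveringRoute.row_of_upper (h : CoveringRoute m n x y E N Q) (hn : 3 ≤ n)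
    (ha : 0 ≤ a) (ham : a + 2 ≤ m) (he : 0 ≤ e) (hs : 0 ≤ s) (hsn : s ≤ n)
    (hes : e + s = m + n - 4 - 2 * a) (hx : n ≤ a + 2 + s)
    (ho : OuterFlow m n Q a) (hi : InnerFlow m n Q a e s) (hη : η < n)
    (hA : ∀ p q, 0 ≤ p → 0 ≤ q → q + 1 < n → p + q = a → N p q)
    (hBE : ∀ p q, 0 ≤ p → p + 1 < m → 0 ≤ q → q < n → q < η → p + q = m + n - 3 - a → E p q)
    (hBN : ∀ p q, 0 ≤ p → p < m → 0 ≤ q → q < n → η ≤ q → p + q = m + n - 3 - a → N p q) :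
    n + s ≤ 2 * η ∧ 2 * η ≤ n + s + 1 := by
  -- While the translation fits, a circuit sends row q of the diagonal `a` to n - 2 - s - q if q + 1
  -- + s < η and to n - 3 - s - q otherwise.
  have up : ∀ q, 0 ≤ q → q + 1 < n → q ≤ a → Q (a - q) q (a - q) (q + 1) := fun q h₁ h₂ h₃ => by
    refine h.north (hA _ _ ?_ ?_ ?_ ?_) ?_ ?_ ?_ ?_ ?_ ?_ <;> omega
  constructor
  · by_contra hc
    have wrap : Q (m - 2 - a) (n - 1) (a + 1) 0 := by
      refine h.northWrap (hBN _ _ ?_ ?_ ?_ ?_ ?_ ?_) ?_ ?_ ?_ ?_ ?_ <;> omega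
    -- For s ≥ n - 2 the cycle runs through the top of the paired diagonal, which wraps north to (a
    -- + 1, 0).
    rcases lt_trichotomy (n - 2 - s) 0 with hM | hM | hM
    · have h1 : Q (a + 1) 0 (m - 2 - a) (n - 1) := by apply hi <;> omega
      have := h.antisymm wrap h1
      omega
    · have h1 : Q a 0 a 1 := by simpa using up 0 le_rfl (by omega) ha
      have h2 : Q a 1 (m - 2 - a) (n - 1) := by apply hi <;> omega
      have h3 : Q (a + 1) 0 (a + 1 + e) s := by apply hi <;> omega
      have h4 : Q (a + 1 + e) s (a + 1 + e) (s + 1) := by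
        refine h.north (hBN _ _ ?_ ?_ ?_ ?_ ?_ ?_) ?_ ?_ ?_ ?_ ?_ ?_ <;> omega
      have h5 : Q (a + 1 + e) (s + 1) a 0 := by apply ho <;> omega
      have := h.antisymm h1 (h.trans h2 (h.trans wrap (h.trans h3 (h.trans h4 h5))))
      omega
    · have back : ∀ q, 0 ≤ q → q < n - 2 - s → η ≤ q + 1 + s →
          Q (a - q) (q + 1) (a - (n - 3 - s - q)) (n - 3 - s - q) := fun q h₁ h₂ h₃ => by
        have h1 : Q (a - q) (q + 1) (a - q + e) (q + 1 + s) := by apply hi <;> omega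
        have h2 : Q (a - q + e) (q + 1 + s) (a - q + e) (q + 2 + s) := by
          refine h.north (hBN _ _ ?_ ?_ ?_ ?_ ?_ ?_) ?_ ?_ ?_ ?_ ?_ ?_ <;> omega
        have h3 : Q (a - q + e) (q + 2 + s) (a - (n - 3 - s - q)) (n - 3 - s - q) := by
          apply ho <;> omega
        exact h.trans h1 (h.trans h2 h3)
      -- The rows next to the centre of the reflection: if η is too small, both q and its mirror
      -- image obey the same rule, and they are exchanged or fixed.
      obtain ⟨q, hq⟩ : ∃ q, q = (n - 2 - s) / 2 := ⟨_, rfl⟩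
      have h1 := up q (by omega) (by omega) (by omega)
      have h2 := back q (by omega) (by omega) (by omega)
      have h3 := up (n - 3 - s - q) (by omega) (by omega) (by omega)
      have h4 := back (n - 3 - s - q) (by omega) (by omega) (by omega)
      have h5 : n - 3 - s - (n - 3 - s - q) = q := by ring
      rw [h5] at h4
      have := h.antisymm h1 (h.trans h2 (h.trans h3 h4))
      omega
  · by_contra hc
    have back : ∀ q, 0 ≤ q → q ≤ n - 2 - s → q + 1 + s < η →
        Q (a - q) (q + 1) (a - (n - 2 - s - q)) (n - 2 - s - q) := fun q h₁ h₂ h₃ => by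
      have h1 : Q (a - q) (q + 1) (a - q + e) (q + 1 + s) := by apply hi <;> omega
      have h2 : Q (a - q + e) (q + 1 + s) (a - q + e + 1) (q + 1 + s) := by
        refine h.east (hBE _ _ ?_ ?_ ?_ ?_ ?_ ?_) ?_ ?_ ?_ ?_ ?_ ?_ <;> omega
      have h3 : Q (a - q + e + 1) (q + 1 + s) (a - (n - 2 - s - q)) (n - 2 - s - q) := by
        apply ho <;> omega
      exact h.trans h1 (h.trans h2 h3)
    obtain ⟨q, hq⟩ : ∃ q, q = (n - 2 - s) / 2 := ⟨_, rfl⟩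
    have h1 := up q (by omega) (by omega) (by omega)
    have h2 := back q (by omega) (by omega) (by omega)
    have h3 := up (n - 2 - s - q) (by omega) (by omega) (by omega)
    have h4 := back (n - 2 - s - q) (by omega) (by omega) (by omega)
    have h5 : n - 2 - s - (n - 2 - s - q) = q := by ring
    rw [h5] at h4
    have := h.antisymm h1 (h.trans h2 (h.trans h3 h4))
    omega

/-- The row of an initial square just after the lower terminal diagonal. -/
theorem CoveringRoute.row_of_lower (h : CoveringRoute m n x y E N Q) (hn : 3 ≤ n)
    (ha : 0 ≤ a) (ham : a + 2 ≤ m) (he : 0 ≤ e) (hs : 0 ≤ s) (hsn : s ≤ n)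
    (hes : e + s = m + n - 4 - 2 * a) (hx : n ≤ a + 2 + s)
    (ho : OuterFlow m n Q a) (hi : InnerFlow m n Q a e s) (hη : η < n) (hη0 : 0 ≤ η)
    (hAE : ∀ p q, 0 ≤ p → 0 ≤ q → q < n → q < η → p + q = a → E p q)
    (hAN : ∀ p q, 0 ≤ p → 0 ≤ q → q + 1 < n → η ≤ q → p + q = a → N p q)
    (hBE : ∀ p q, 0 ≤ p → p + 1 < m → 0 ≤ q → q < n → p + q = m + n - 3 - a → E p q)
    (hηa : η ≤ a + 1) :
    n - s - 1 ≤ 2 * η ∧ 2 * η ≤ n - s := by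
  constructor
  · by_contra hc
    -- Here the reflections are q ↦ n - 2 - s - q for rows q ≥ η, which leave north, and q ↦ n - 1 -
    -- s - q for rows q < η, which leave east.
    have step : ∀ q, 0 ≤ q → q < n - 1 - s → η ≤ q → Q (a - q) q (a - q) (q + 1) ∧
        Q (a - q) (q + 1) (a - (n - 2 - s - q)) (n - 2 - s - q) := fun q h₁ h₂ h₃ => by
      have h0 : Q (a - q) q (a - q) (q + 1) := by
        refine h.north (hAN _ _ ?_ ?_ ?_ ?_ ?_) ?_ ?_ ?_ ?_ ?_ ?_ <;> omega
      have h1 : Q (a - q) (q + 1) (a - q + e) (q + 1 + s) := by apply hi <;> omega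
      have h2 : Q (a - q + e) (q + 1 + s) (a - q + e + 1) (q + 1 + s) := by
        refine h.east (hBE _ _ ?_ ?_ ?_ ?_ ?_) ?_ ?_ ?_ ?_ ?_ ?_ <;> omega
      have h3 : Q (a - q + e + 1) (q + 1 + s) (a - (n - 2 - s - q)) (n - 2 - s - q) := by
        apply ho <;> omega
      exact ⟨h0, h.trans h1 (h.trans h2 h3)⟩
    obtain ⟨q, hq⟩ : ∃ q, q = (n - 1 - s) / 2 := ⟨_, rfl⟩
    obtain ⟨h1, h2⟩ := step q (by omega) (by omega) (by omega)
    obtain ⟨h3, h4⟩ := step (n - 2 - s - q) (by omega) (by omega) (by omega)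
    have h5 : n - 2 - s - (n - 2 - s - q) = q := by ring
    rw [h5] at h4
    have := h.antisymm h1 (h.trans h2 (h.trans h3 h4))
    omega
  · by_contra hc
    -- For s = n even row 0 is half-turned rather than translated, so its cycle is written out
    -- separately.
    rcases hsn.eq_or_lt with hsn | hsn
    · have h1 : Q a 0 (a + 1) 0 := by
        refine h.east (hAE _ _ ?_ ?_ ?_ ?_ ?_) ?_ ?_ ?_ ?_ ?_ ?_ <;> omega
      have h2 : Q (a + 1) 0 (m - 2 - a) (n - 1) := by apply hi <;> omega
      have h3 : Q (m - 2 - a) (n - 1) (m - 1 - a) (n - 1) := by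
        refine h.east (hBE _ _ ?_ ?_ ?_ ?_ ?_) ?_ ?_ ?_ ?_ ?_ ?_ <;> omega
      have h4 : Q (m - 1 - a) (n - 1) a 0 := by apply ho <;> omega
      have := h.antisymm h1 (h.trans h2 (h.trans h3 h4))
      omega
    have step : ∀ q, 0 ≤ q → q ≤ n - 1 - s → q < η → n - 2 - a - s < q →
        Q (a - q) q (a - q + 1) q ∧
        Q (a - q + 1) q (a - (n - 1 - s - q)) (n - 1 - s - q) := fun q h₁ h₂ h₃ h₄ => by
      have h0 : Q (a - q) q (a - q + 1) q := by
        refine h.east (hAE _ _ ?_ ?_ ?_ ?_ ?_) ?_ ?_ ?_ ?_ ?_ ?_ <;> omega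
      have h1 : Q (a - q + 1) q (a - q + 1 + e) (q + s) := by apply hi <;> omega
      have h2 : Q (a - q + 1 + e) (q + s) (a - q + e + 2) (q + s) := by
        refine h.east (hBE _ _ ?_ ?_ ?_ ?_ ?_) ?_ ?_ ?_ ?_ ?_ ?_ <;> omega
      have h3 : Q (a - q + e + 2) (q + s) (a - (n - 1 - s - q)) (n - 1 - s - q) := by
        apply ho <;> omega
      exact ⟨h0, h.trans h1 (h.trans h2 h3)⟩
    obtain ⟨q, hq⟩ : ∃ q, q = (n - 1 - s) / 2 := ⟨_, rfl⟩
    obtain ⟨h1, h2⟩ := step q (by omega) (by omega) (by omega) (by omega)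
    obtain ⟨h3, h4⟩ := step (n - 1 - s - q) (by omega) (by omega) (by omega) (by omega)
    have h5 : n - 1 - s - (n - 1 - s - q) = q := by ring
    rw [h5] at h4
    have := h.antisymm h1 (h.trans h2 (h.trans h3 h4))
    omega

/-- The row of an initial square just after a diagonal that is carried to itself by a reversal of
the rows. -/
theorem CoveringRoute.row_of_reversal (h : CoveringRoute m n x y E N Q) {b : ℤ} (hn : 3 ≤ n)
    (hbn : n ≤ b + 1) (hbm : b + 2 ≤ m) (hη : η < n) (hη0 : 0 ≤ η)
    (hE : ∀ p q, 0 ≤ p → 0 ≤ q → q < n → q < η → p + q = b → E p q)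
    (hN : ∀ p q, 0 ≤ p → 0 ≤ q → q + 1 < n → η ≤ q → p + q = b → N p q)
    (hQ : ∀ p q p' q', 0 ≤ p → p < m → 0 ≤ q → q < n → p + q = b + 1 → p' + q' = b →
      q' = n - 1 - q → Q p q p' q') : η = n / 2 := by
  rcases lt_trichotomy η (n / 2) with hc | hc | hc
  · have step : ∀ q, 0 ≤ q → q + 1 < n → η ≤ q → Q (b - q) q (b - q) (q + 1) ∧
        Q (b - q) (q + 1) (b - (n - 2 - q)) (n - 2 - q) := fun q h₁ h₂ h₃ => by
      constructor
      · refine h.north (hN _ _ ?_ ?_ ?_ ?_ ?_) ?_ ?_ ?_ ?_ ?_ ?_ <;> omega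
      · apply hQ <;> omega
    obtain ⟨q, hq⟩ : ∃ q, q = (n - 2) / 2 := ⟨_, rfl⟩
    obtain ⟨h1, h2⟩ := step q (by omega) (by omega) (by omega)
    obtain ⟨h3, h4⟩ := step (n - 2 - q) (by omega) (by omega) (by omega)
    have h5 : n - 2 - (n - 2 - q) = q := by ring
    rw [h5] at h4
    have := h.antisymm h1 (h.trans h2 (h.trans h3 h4))
    omega
  · exact hc
  · have step : ∀ q, 0 ≤ q → q < n → q < η → Q (b - q) q (b - q + 1) q ∧
        Q (b - q + 1) q (b - (n - 1 - q)) (n - 1 - q) := fun q h₁ h₂ h₃ => by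
      constructor
      · refine h.east (hE _ _ ?_ ?_ ?_ ?_ ?_) ?_ ?_ ?_ ?_ ?_ ?_ <;> omega
      · apply hQ <;> omega
    obtain ⟨q, hq⟩ : ∃ q, q = (n - 1) / 2 := ⟨_, rfl⟩
    obtain ⟨h1, h2⟩ := step q (by omega) (by omega) (by omega)
    obtain ⟨h3, h4⟩ := step (n - 1 - q) (by omega) (by omega) (by omega)
    have h5 : n - 1 - (n - 1 - q) = q := by ring
    rw [h5] at h4
    have := h.antisymm h1 (h.trans h2 (h.trans h3 h4))
    omega

end Terminal

/-! ### Necessity: locating the terminal square and then the initial one. -/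

section Initial

variable {m n x y : ℤ} {E N : ℤ → ℤ → Prop} {Q : ℤ → ℤ → ℤ → ℤ → Prop} {a e s : ℤ}

/-- The flow is assembled from the middle outwards. The last clause records that the short diagonals
cannot mix directions: with s ≥ 2(n - 2 - i) the bound for an east step fails for i < n - 2, and
with s = 0 the bound for a north step fails there. -/
theorem CoveringRoute.exists_innerFlow (h : CoveringRoute m n x y E N Q) (hn : 3 ≤ n)
    (hnm : n ≤ m) (k : ℕ) (hk : k ≤ (m + n - 4) / 2 + 1)
    (hc : ∀ i, (m + n - 4) / 2 - k < i → 2 * i ≤ m + n - 3 → HoldsOn m n E i ∨ HoldsOn m n N i) :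
    ∃ e s : ℤ, 0 ≤ e ∧ 0 ≤ s ∧ e + s = m + n - 4 - 2 * ((m + n - 4) / 2 - k) ∧ s ≤ n ∧
      InnerFlow m n Q ((m + n - 4) / 2 - k) e s ∧
      ((m + n - 4) / 2 - k + 2 ≤ n → s = 0 ∧ e ≤ m ∨ 2 * (n - 2 - ((m + n - 4) / 2 - k)) ≤ s) := by
  induction k with
  | zero =>
    push_cast at *
    rw [sub_zero] at *
    -- For m + n even the innermost paired diagonals are adjacent; for m + n odd a self-paired
    -- diagonal lies between them and contributes a single step.
    rcases Int.emod_two_eq_zero_or_one (m + n) with hmod | hmod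
    · exact ⟨0, 0, by omega, by omega, by omega, by omega,
        InnerFlow.of_adjacent h.toRoute (by omega), by omega⟩
    · rcases hc ((m + n - 4) / 2 + 1) (by omega) (by omega) with hE | hN
      · exact ⟨1, 0, by omega, by omega, by omega, by omega,
          InnerFlow.of_east h.toRoute (by omega) hE, by omega⟩
      · exact ⟨0, 1, by omega, by omega, by omega, by omega,
          InnerFlow.of_north h.toRoute (by omega) hN, by omega⟩
  | succ k ih =>
    obtain ⟨e, s, he, hs, hes, hsn, hi, hJ⟩ := ih (by push_cast at *; omega) fun i h₁ h₂ =>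
      hc i (by push_cast at *; omega) h₂
    have hk' : (m + n - 4) / 2 - (k + 1 : ℕ) = (m + n - 4) / 2 - k - 1 := by push_cast; ring
    rw [hk'] at *
    obtain ⟨i, hi'⟩ : ∃ i, i = (m + n - 4) / 2 - (k : ℤ) := ⟨_, rfl⟩
    rw [← hi'] at hes hi hJ ⊢
    rcases hc i (by omega) (by omega) with hE | hN
    · refine ⟨e + 2, s, by omega, by omega, by omega, hsn,
        InnerFlow.east h.toRoute hE he hs hes hi, fun hin => ?_⟩
      by_cases hin' : i + 2 ≤ n
      · have := h.east_bound (by push_cast at hk; omega) hin' hE he hs hes hi (by omega)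
        omega
      · omega
    · have := h.north_bound (by push_cast at hk; omega) (by omega) hN he hs hes hi (by omega)
      exact ⟨e, s + 2, by omega, by omega, by omega, by omega,
        InnerFlow.north h.toRoute hN he hs hes hi, by omega⟩

/-- The last two hypotheses say that (m - 1, n - 2 - a) is terminal. Its neighbours along the two
diagonals then have forced directions as far as the initial square, which is the situation of
`row_of_lower` or `row_of_upper`. -/
theorem CoveringRoute.initial_of_corner (h : CoveringRoute m n x y E N Q) (hn : 3 ≤ n)
    (hm : 3 ≤ m) (ha : 0 ≤ a) (han : a + 2 ≤ n) (ham : a + 2 ≤ m) (he : 0 ≤ e) (hs : 0 ≤ s)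
    (hsn : s ≤ n) (hes : e + s = m + n - 4 - 2 * a) (hx : n ≤ a + 2 + s)
    (ho : OuterFlow m n Q a) (hi : InnerFlow m n Q a e s)
    (hx0 : 0 ≤ x) (hxm : x < m) (hy0 : 0 ≤ y) (hyn : y < n)
    (hxy : x + y = a + 1 ∨ x + y = m + n - 2 - a)
    (hE : ¬ E (m - 1) (n - 2 - a)) (hN : ¬ N (m - 1) (n - 2 - a)) :
    x = 0 ∧ y = a + 1 ∨ x + y = a + 1 ∧ n - s - 1 ≤ 2 * y ∧ 2 * y ≤ n - s ∨
      x + y = m + n - 2 - a ∧ n + s ≤ 2 * y ∧ 2 * y ≤ n + s + 1 := by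
  by_cases hι : x = 0 ∧ y = a + 1
  · exact Or.inl hι
  right
  have top : N 0 a := (h.coverLeft ha (by omega) (by omega)).resolve_left hE
  have top' : ¬ E 0 a := fun h₁ => by have := h.excl h₁ top; omega
  have hBE : ∀ p q, p + q = m + n - 3 - a → p + 1 < m → 0 ≤ p → q < n →
      (x + y = m + n - 2 - a → q < y) → E p q := fun p q h₁ h₂ h₃ h₄ h₅ =>
    h.east_above hN (by omega) (by omega) (by omega) (by omega) h₃ h₄ (by omega)
  have hAN : ∀ p q, p + q = a → 0 ≤ p → 0 ≤ q → (x + y = a + 1 → y ≤ q) → N p q :=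
    fun p q h₁ h₂ h₃ h₄ => by
      by_cases hp : p = 0
      · obtain rfl : q = a := by omega
        rwa [hp]
      · exact h.north_below top' (by omega) le_rfl (by omega) (by omega) h₃ (by omega) (by omega)
  rcases hxy with hxy | hxy
  · refine Or.inl ⟨hxy, ?_⟩
    refine h.row_of_lower hn ha ham he hs hsn hes hx ho hi hyn hy0 ?_ ?_ ?_ (by omega)
    · intro p q h₁ h₂ h₃ h₄ h₅
      have hB : ¬ N (m - 2 - a) (n - 1) := fun h₆ => by
        have := h.excl (hBE _ _ ?_ ?_ ?_ ?_ ?_) h₆ <;> omega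
      have hA : E a 0 := (h.coverBottom ha (by omega) (by omega)).resolve_right hB
      rcases h₂.eq_or_lt with rfl | h₂
      · obtain rfl : p = a := by omega
        exact hA
      · refine h.east_above (p := a) (q := 0) (fun h₆ => ?_) (by omega) le_rfl (by omega) h₂ h₁ h₃
          (by omega)
        have := h.excl hA h₆; omega
    · exact fun p q h₁ h₂ h₃ h₄ h₅ => hAN p q h₅ h₁ h₂ fun _ => h₄
    · exact fun p q h₁ h₂ h₃ h₄ h₅ => hBE p q h₅ h₂ h₁ h₄ (by omega)
  · refine Or.inr ⟨hxy, ?_⟩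
    refine h.row_of_upper hn ha ham he hs hsn hes hx ho hi hyn ?_ ?_ ?_
    · exact fun p q h₁ h₂ h₃ h₄ => hAN p q h₄ h₁ h₂ (by omega)
    · exact fun p q h₁ h₂ h₃ h₄ h₅ h₆ => hBE p q h₆ h₂ h₁ h₄ fun _ => h₅
    · intro p q h₁ h₂ h₃ h₄ h₅ h₆
      have hA : ¬ E a 0 := fun h₇ => by
        have := h.excl h₇ (hAN a 0 (by omega) ha le_rfl (by omega)); omega
      have hB : N (m - 2 - a) (n - 1) :=
        (h.coverBottom ha (by omega) (by omega)).resolve_left hA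
      by_cases hq : q = n - 1
      · obtain rfl : p = m - 2 - a := by omega
        rwa [hq]
      · refine h.north_below (p := m - 2 - a) (q := n - 1) (fun h₇ => ?_) (by omega) (by omega)
          (by omega) (by omega) h₃ h₂ (by omega)
        have := h.excl h₇ hB; omega

/-- When n < a + 2 + s, the inner flow half-turns (0, a + 1) to (m - 1, n - 2 - a). Leaving the
latter east leads straight back to (0, a + 1), and leaving it north does so through the outer
region; hence it is terminal, unless the initial square is (0, a + 1) itself. -/
theorem CoveringRoute.initial_of_excess (h : CoveringRoute m n x y E N Q) (hn : 3 ≤ n)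
    (hm : 3 ≤ m) (ha : 0 ≤ a) (han : a + 2 ≤ n) (ham : a + 2 ≤ m) (he : 0 ≤ e) (hs : 0 ≤ s)
    (hsn : s ≤ n) (hes : e + s = m + n - 4 - 2 * a) (hx : n < a + 2 + s)
    (ho : OuterFlow m n Q a) (hi : InnerFlow m n Q a e s)
    (hx0 : 0 ≤ x) (hxm : x < m) (hy0 : 0 ≤ y) (hyn : y < n)
    (hxy : x + y = a + 1 ∨ x + y = m + n - 2 - a) :
    x = 0 ∧ y = a + 1 ∨ x + y = a + 1 ∧ n - s - 1 ≤ 2 * y ∧ 2 * y ≤ n - s ∨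
      x + y = m + n - 2 - a ∧ n + s ≤ 2 * y ∧ 2 * y ≤ n + s + 1 := by
  have hE : ¬ E (m - 1) (n - 2 - a) := fun h₁ => by
    have h2 : Q (m - 1) (n - 2 - a) 0 (a + 1) := by apply h.eastWrap h₁ <;> omega
    have h3 : Q 0 (a + 1) (m - 1) (n - 2 - a) := by apply hi <;> omega
    have := h.antisymm h2 h3; omega
  by_cases hι : x = 0 ∧ y = a + 1
  · exact Or.inl hι
  have top : N 0 a := (h.coverLeft ha (by omega) (by omega)).resolve_left hE
  have hN : ¬ N (m - 1) (n - 2 - a) := fun h₁ => by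
    have h2 : Q (m - 1) (n - 2 - a) (m - 1) (n - 1 - a) := by apply h.north h₁ <;> omega
    have h3 : Q (m - 1) (n - 1 - a) 0 a := by apply ho <;> omega
    have h4 : Q 0 a 0 (a + 1) := by apply h.north top <;> omega
    have h5 : Q 0 (a + 1) (m - 1) (n - 2 - a) := by apply hi <;> omega
    have := h.antisymm h2 (h.trans h3 (h.trans h4 h5)); omega
  exact h.initial_of_corner hn hm ha han ham he hs hsn hes hx.le ho hi hx0 hxm hy0 hyn hxy hE hN

/-- The paired diagonal ends at (m - 1, 0) and (m - n, n - 1). Each end leads to the other whichever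
way it is left, so one of them is terminal; `initial_of_corner` or its transpose then applies. -/
theorem CoveringRoute.initial_of_tight (h : CoveringRoute m n x y E N Q) (hn : 3 ≤ n)
    (hnm : n ≤ m) (ha : a + 2 = n) (hab : 2 * a < m + n - 3) (he : e = m - n)
    (ho : OuterFlow m n Q a) (hi : InnerFlow m n Q a e 0)
    (hx0 : 0 ≤ x) (hxm : x < m) (hy0 : 0 ≤ y) (hyn : y < n)
    (hxy : x + y = a + 1 ∨ x + y = m + n - 2 - a) :
    x = 0 ∧ y = n - 1 ∨ x = n - 1 ∧ y = 0 ∨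
      x + y = a + 1 ∧ n - 1 ≤ 2 * y ∧ 2 * y ≤ n ∨
      x + y = m + n - 2 - a ∧ n ≤ 2 * y ∧ 2 * y ≤ n + 1 ∨
      x + y = a + 1 ∧ n - 1 ≤ 2 * x ∧ 2 * x ≤ n ∨
      x + y = m + n - 2 - a ∧ 2 * m - n ≤ 2 * x ∧ 2 * x ≤ 2 * m - n + 1 := by
  by_cases hι : x = 0 ∧ y = n - 1
  · exact Or.inl hι
  by_cases hι' : x = n - 1 ∧ y = 0
  · exact Or.inr (Or.inl hι')
  have hleft : E (m - 1) 0 ∨ N 0 (n - 2) := by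
    have := h.coverLeft (q := n - 2) (by omega) (by omega) (by omega)
    rwa [sub_self] at this
  have hbottom : N (m - n) (n - 1) ∨ E (n - 2) 0 := by
    have := h.coverBottom (p := n - 2) (by omega) (by omega) (by omega)
    rw [or_comm]
    convert this using 2
    ring
  have h1 : Q 0 (n - 1) (m - n) (n - 1) := by apply hi <;> omega
  have h2 : Q (n - 1) 0 (m - 1) 0 := by apply hi <;> omega
  have hBE : E (m - 1) 0 → Q (m - 1) 0 (m - n) (n - 1) := fun h₁ =>
    h.trans (by apply h.eastWrap h₁ (p' := 0) (q' := n - 1) <;> omega) h1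
  have hTN : N (m - n) (n - 1) → Q (m - n) (n - 1) (m - 1) 0 := fun h₁ =>
    h.trans (by apply h.northWrap h₁ (p' := n - 1) (q' := 0) <;> omega) h2
  have hBN : N (m - 1) 0 → N 0 (n - 2) → Q (m - 1) 0 (m - n) (n - 1) := fun h₁ h₂ => by
    have h3 : Q (m - 1) 0 (m - 1) 1 := by apply h.north h₁ <;> omega
    have h4 : Q (m - 1) 1 0 (n - 2) := by apply ho <;> omega
    have h5 : Q 0 (n - 2) 0 (n - 1) := by apply h.north h₂ <;> omega
    exact h.trans h3 (h.trans h4 (h.trans h5 h1))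
  have hTE : E (m - n) (n - 1) → E (n - 2) 0 → Q (m - n) (n - 1) (m - 1) 0 := fun h₁ h₂ => by
    have h3 : Q (m - n) (n - 1) (m - n + 1) (n - 1) := by apply h.east h₁ <;> omega
    have h4 : Q (m - n + 1) (n - 1) (n - 2) 0 := by apply ho <;> omega
    have h5 : Q (n - 2) 0 (n - 1) 0 := by apply h.east h₂ <;> omega
    exact h.trans h3 (h.trans h4 (h.trans h5 h2))
  have key : ¬ (Q (m - 1) 0 (m - n) (n - 1) ∧ Q (m - n) (n - 1) (m - 1) 0) := fun h₁ => by
    have := h.antisymm h₁.1 h₁.2; omega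
  have hcases : ¬ E (m - 1) 0 ∧ ¬ N (m - 1) 0 ∨ ¬ E (m - n) (n - 1) ∧ ¬ N (m - n) (n - 1) := by
    by_contra hc
    by_cases h₁ : E (m - 1) 0
    · have hBt : ¬ N (m - n) (n - 1) := fun h₂ => key ⟨hBE h₁, hTN h₂⟩
      have hA := hbottom.resolve_left hBt
      exact hc (Or.inr ⟨fun h₂ => key ⟨hBE h₁, hTE h₂ hA⟩, hBt⟩)
    · have hA := hleft.resolve_left h₁
      by_cases h₂ : N (m - 1) 0
      · have hBt : ¬ N (m - n) (n - 1) := fun h₃ => key ⟨hBN h₂ hA, hTN h₃⟩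
        have hA' := hbottom.resolve_left hBt
        exact hc (Or.inr ⟨fun h₃ => key ⟨hBN h₂ hA, hTE h₃ hA'⟩, hBt⟩)
      · exact hc (Or.inl ⟨h₁, h₂⟩)
  rcases hcases with ⟨hE, hN⟩ | ⟨hE, hN⟩
  · have := h.initial_of_corner (a := a) (e := e) (s := 0) hn (by omega) (by omega) (by omega)
      (by omega) (by omega) (by omega) (by omega) (by omega) (by omega) ho hi hx0 hxm hy0 hyn hxy
      (by convert hE using 2; omega) (by convert hN using 2; omega)
    omega
  · have := h.transpose.initial_of_corner (a := a) (e := 0) (s := e) (by omega) (by omega)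
      (by omega) (by omega)
      (by omega) (by omega) (by omega) (by omega) (by omega) (by omega) ho.transpose hi.transpose
      hy0 hyn hx0 hxm (by omega)
      (by convert hN using 2; omega) (by convert hE using 2; omega)
    omega

/-- Both terminal diagonals now meet every row. The top of the diagonal `a` cannot travel north, by
a cycle through the half-turn. Either it is terminal, or it travels east; the latter forces s = 0
and makes the top of the paired diagonal terminal. -/
theorem CoveringRoute.initial_of_long (h : CoveringRoute m n x y E N Q) (hn : 3 ≤ n)
    (han : n ≤ a + 1) (hab : 2 * a < m + n - 3) (he : 0 ≤ e) (hs : 0 ≤ s)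
    (hsn : s ≤ n) (hes : e + s = m + n - 4 - 2 * a)
    (ho : OuterFlow m n Q a) (hi : InnerFlow m n Q a e s)
    (hx0 : 0 ≤ x) (hy0 : 0 ≤ y) (hyn : y < n)
    (hxy : x + y = a + 1 ∨ x + y = m + n - 2 - a) :
    y = 0 ∨ x + y = a + 1 ∧ n - s - 1 ≤ 2 * y ∧ 2 * y ≤ n - s ∨
      x + y = m + n - 2 - a ∧ n + s ≤ 2 * y ∧ 2 * y ≤ n + s + 1 ∨
      x + y = m + n - 2 - a ∧ y = n / 2 := by
  by_cases hy : y = 0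
  · exact Or.inl hy
  right
  have hAtopN : ¬ N (a - n + 1) (n - 1) := fun h₁ => by
    have h₂ : Q (a - n + 1) (n - 1) (m + n - 2 - a) 0 := by apply h.northWrap h₁ <;> omega
    have h₃ : Q (m + n - 2 - a) 0 (a - n + 1) (n - 1) := by apply ho <;> omega
    have := h.antisymm h₂ h₃
    omega
  have hB0 : E (m + n - 3 - a) 0 := by
    refine (h.coverBottom (by omega) (by omega) (by omega)).resolve_right ?_
    convert hAtopN using 2
    omega
  have hBE : ∀ p q, p + q = m + n - 3 - a → 0 ≤ p → 0 ≤ q → q < n →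
      (x + y = m + n - 2 - a → q < y) → E p q := fun p q h₁ h₂ h₃ h₄ h₅ => by
    rcases h₃.eq_or_lt with rfl | h₃
    · obtain rfl : p = m + n - 3 - a := by omega
      exact hB0
    · refine h.east_above (p := m + n - 3 - a) (q := 0) (fun h₆ => ?_) (by omega) le_rfl (by omega)
        h₃ h₂ h₄ (by omega)
      have := h.excl hB0 h₆; omega
  have hB0o : Q (m + n - 3 - a) 0 (a - n + 1) (n - 1) := by
    have h1 : Q (m + n - 3 - a) 0 (m + n - 2 - a) 0 := by
      apply h.east hB0 <;> omega
    have h2 : Q (m + n - 2 - a) 0 (a - n + 1) (n - 1) := by apply ho <;> omega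
    exact h.trans h1 h2
  by_cases hAtopE : E (a - n + 1) (n - 1)
  · have h1 : Q (a - n + 1) (n - 1) (a - n + 2) (n - 1) := by
      apply h.east hAtopE <;> omega
    rcases hs.eq_or_lt with rfl | hs
    · have h2 : Q (a - n + 2) (n - 1) (m - 2 - a) (n - 1) := by apply hi <;> omega
      have h3 : Q (a + 1) 0 (m + n - 3 - a) 0 := by apply hi <;> omega
      have hBtopN : ¬ N (m - 2 - a) (n - 1) := fun h₁ => by
        have h4 : Q (m - 2 - a) (n - 1) (a + 1) 0 := by apply h.northWrap h₁ <;> omega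
        have := h.antisymm h1 (h.trans h2 (h.trans h4 (h.trans h3 hB0o)))
        omega
      have hA0 : E a 0 := (h.coverBottom (by omega) (by omega) (by omega)).resolve_right hBtopN
      have hBtopE : ¬ E (m - 2 - a) (n - 1) := fun h₁ => by
        have h4 : Q (m - 2 - a) (n - 1) (m - 1 - a) (n - 1) := by apply h.east h₁ <;> omega
        have h5 : Q (m - 1 - a) (n - 1) a 0 := by apply ho <;> omega
        have h6 : Q a 0 (a + 1) 0 := by apply h.east hA0 <;> omega
        have := h.antisymm h1 (h.trans h2 (h.trans h4 (h.trans h5 (h.trans h6 (h.trans h3 hB0o)))))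
        omega
      have hxy' : x + y = m + n - 2 - a := by
        by_contra hne
        apply hBtopE
        apply hBE <;> omega
      refine Or.inr (Or.inr ⟨hxy', ?_⟩)
      have hAE : ∀ p q, 0 ≤ p → 0 ≤ q → q < n → p + q = a → E p q := fun p q h₁ h₂ h₃ h₄ => by
        rcases h₂.eq_or_lt with rfl | h₂
        · obtain rfl : p = a := by omega
          exact hA0
        · refine h.east_above (p := a) (q := 0) (fun h₆ => ?_) (by omega) le_rfl (by omega) h₂ h₁ h₃
            (by omega)
          have := h.excl hA0 h₆; omega
      -- From the diagonal after b, the half-turn, an east step and the horizontal translation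
      -- return to b with the rows reversed.
      refine h.row_of_reversal (b := m + n - 3 - a) hn (by omega) (by omega) hyn hy0 ?_ ?_ ?_
      · exact fun p q h₁ h₂ h₃ h₄ h₅ => hBE p q h₅ h₁ h₂ h₃ fun _ => h₄
      · intro p q h₁ h₂ h₃ h₄ h₅
        exact h.north_below hBtopE (by omega) (by omega) (by omega) (by omega) h₂ (by omega)
          (by omega)
      · intro p q p' q' h₁ h₂ h₃ h₄ h₅ h₆ h₇
        have h1 : Q p q (m - 1 - p) (n - 1 - q) := by apply ho <;> omega
        have h2 : Q (m - 1 - p) (n - 1 - q) (m - p) (n - 1 - q) := by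
          refine h.east (hAE _ _ ?_ ?_ ?_ ?_) ?_ ?_ ?_ ?_ ?_ ?_ <;> omega
        have h3 : Q (m - p) (n - 1 - q) p' q' := by apply hi <;> omega
        exact h.trans h1 (h.trans h2 h3)
    · have h2 : Q (a - n + 2) (n - 1) (m + n - 3 - a) 0 := by apply hi <;> omega
      have := h.antisymm h1 (h.trans h2 hB0o)
      omega
  · have hAN : ∀ p q, p + q = a → 0 ≤ p → 0 ≤ q → q + 1 < n → (x + y = a + 1 → y ≤ q) → N p q :=
      fun p q h₁ h₂ h₃ h₄ h₅ => h.north_below hAtopE (by omega) (by omega) (by omega) (by omega)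
        h₃ (by omega) (by omega)
    rcases hxy with hxy | hxy
    · refine Or.inl ⟨hxy, ?_⟩
      refine h.row_of_lower hn (by omega) (by omega) he hs hsn hes (by omega) ho hi hyn hy0 ?_ ?_
        ?_ (by omega)
      · intro p q h₁ h₂ h₃ h₄ h₅
        have hB : ¬ N (m - 2 - a) (n - 1) := fun h₆ => by
          have := h.excl (hBE _ _ ?_ ?_ ?_ ?_ ?_) h₆ <;> omega
        have hA : E a 0 := (h.coverBottom (by omega) (by omega) (by omega)).resolve_right hB
        rcases h₂.eq_or_lt with rfl | h₂
        · obtain rfl : p = a := by omega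
          exact hA
        · refine h.east_above (p := a) (q := 0) (fun h₆ => ?_) (by omega) le_rfl (by omega) h₂ h₁ h₃
            (by omega)
          have := h.excl hA h₆; omega
      · exact fun p q h₁ h₂ h₃ h₄ h₅ => hAN p q h₅ h₁ h₂ h₃ fun _ => h₄
      · exact fun p q h₁ h₂ h₃ h₄ h₅ => hBE p q h₅ h₁ h₃ h₄ (by omega)
    · refine Or.inr (Or.inl ⟨hxy, ?_⟩)
      refine h.row_of_upper hn (by omega) (by omega) he hs hsn hes (by omega) ho hi hyn ?_ ?_ ?_
      · exact fun p q h₁ h₂ h₃ h₄ => hAN p q h₄ h₁ h₂ h₃ (by omega)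
      · exact fun p q h₁ h₂ h₃ h₄ h₅ h₆ => hBE p q h₆ h₁ h₃ h₄ fun _ => h₅
      · intro p q h₁ h₂ h₃ h₄ h₅ h₆
        have hA : ¬ E a 0 := fun h₇ => by
          have := h.excl h₇ (hAN a 0 (by omega) (by omega) le_rfl (by omega) (by omega)); omega
        have hB : N (m - 2 - a) (n - 1) :=
          (h.coverBottom (by omega) (by omega) (by omega)).resolve_left hA
        by_cases hq : q = n - 1
        · obtain rfl : p = m - 2 - a := by omega
          rwa [hq]
        · refine h.north_below (p := m - 2 - a) (q := n - 1) (fun h₇ => ?_) (by omega) (by omega)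
            (by omega) (by omega) h₃ h₂ (by omega)
          have := h.excl h₇ hB; omega

/-- The diagonal is its own partner, so the outer half-turn alone returns to it and reverses the
rows. -/
theorem CoveringRoute.initial_of_middle (h : CoveringRoute m n x y E N Q) (hn : 3 ≤ n)
    (hnm : n ≤ m) (hab : 2 * a = m + n - 3) (ho : OuterFlow m n Q a)
    (hx0 : 0 ≤ x) (hy0 : 0 ≤ y) (hyn : y < n) (hxy : x + y = a + 1) :
    y = 0 ∨ y = n / 2 := by
  by_cases hy : y = 0
  · exact Or.inl hy
  right
  have hNtop : ¬ N (a - n + 1) (n - 1) := fun h₁ => by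
    have h₂ : Q (a - n + 1) (n - 1) (a + 1) 0 := by apply h.northWrap h₁ <;> omega
    have h₃ : Q (a + 1) 0 (a - n + 1) (n - 1) := by apply ho <;> omega
    have := h.antisymm h₂ h₃
    omega
  have hE0 : E a 0 := by
    refine (h.coverBottom (by omega) (by omega) (by omega)).resolve_right ?_
    convert hNtop using 2
    omega
  have hEtop : ¬ E (a - n + 1) (n - 1) := fun h₁ => by
    have h2 : Q (a - n + 1) (n - 1) (a - n + 2) (n - 1) := by apply h.east h₁ <;> omega
    have h3 : Q (a - n + 2) (n - 1) a 0 := by apply ho <;> omega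
    have h4 : Q a 0 (a + 1) 0 := by apply h.east hE0 <;> omega
    have h5 : Q (a + 1) 0 (a - n + 1) (n - 1) := by apply ho <;> omega
    have := h.antisymm h2 (h.trans h3 (h.trans h4 h5))
    omega
  refine h.row_of_reversal (b := a) hn (by omega) (by omega) hyn hy0 ?_ ?_ ?_
  · intro p q h₁ h₂ h₃ h₄ h₅
    rcases h₂.eq_or_lt with rfl | h₂
    · obtain rfl : p = a := by omega
      exact hE0
    · refine h.east_above (p := a) (q := 0) (fun h₆ => ?_) (by omega) le_rfl (by omega) h₂ h₁ h₃
        (by omega)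
      have := h.excl hE0 h₆; omega
  · intro p q h₁ h₂ h₃ h₄ h₅
    exact h.north_below hEtop (by omega) (by omega) (by omega) (by omega) h₂ (by omega) (by omega)
  · intro p q p' q' h₁ h₂ h₃ h₄ h₅ h₆ h₇
    apply ho <;> omega

/-- The necessary condition on the initial square. -/
theorem CoveringRoute.initial_mem (h : CoveringRoute m n x y E N Q) (hn : 3 ≤ n)
    (hnm : n ≤ m) (hx0 : 0 ≤ x) (hxm : x < m) (hy0 : 0 ≤ y) (hyn : y < n) :
    (x = 0 ∧ (n - 1) / 2 ≤ y) ∨ ((n - 1) / 2 ≤ x ∧ y = 0) ∨ ((m + 1) / 2 ≤ x ∧ y = n / 2) ∨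
      (x ≤ n / 2 ∧ y = (n - 1) / 2) ∨ (m / 2 ≤ x ∧ x ≤ m - (n + 1) / 2 ∧ n / 2 + 1 ≤ y) ∨
      ((n - 1) / 2 ≤ x ∧ x ≤ (m - 1) / 2 ∧ y ≤ n / 2) := by
  obtain ⟨a, hab, hxy, ha⟩ : ∃ a, 2 * a ≤ m + n - 3 ∧ (x + y = a + 1 ∨ x + y = m + n - 2 - a) ∧
      -1 ≤ a := by
    rcases le_or_gt (2 * (x + y - 1)) (m + n - 3) with hc | hc
    · exact ⟨x + y - 1, hc, Or.inl (by ring), by omega⟩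
    · exact ⟨m + n - 2 - (x + y), by omega, Or.inr (by ring), by omega⟩
  have hconst : ∀ i, 0 ≤ i → 2 * i ≤ m + n - 3 → i ≠ a → HoldsOn m n E i ∨ HoldsOn m n N i :=
    fun i h₁ h₂ h₃ => h.holdsOn h₁ (by omega) (by omega) (by omega) (by omega) (by omega)
  have ho : 0 ≤ a → OuterFlow m n Q a := by
    intro ha
    lift a to ℕ using ha
    refine OuterFlow.of_corner h.toRoute ?_ a fun i h₁ h₂ => hconst i h₁ (by omega) (by omega)
    rcases h.coverCorner (by omega) with h₁ | h₁
    · apply h.eastWrap h₁ <;> omega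
    · apply h.northWrap h₁ <;> omega
  rcases hab.eq_or_lt with hab | hab
  · rcases h.initial_of_middle hn hnm hab (ho (by omega)) hx0 hy0 hyn (by omega) with h₁ | h₁ <;>
    omega
  obtain ⟨k, hk⟩ : ∃ k : ℕ, a = (m + n - 4) / 2 - k := ⟨((m + n - 4) / 2 - a).toNat, by omega⟩
  obtain ⟨e, s, he, hs, hes, hsn, hi, hJ⟩ := h.exists_innerFlow hn hnm k (by omega)
    fun i h₁ h₂ => hconst i (by omega) h₂ (by omega)
  rw [← hk] at hes hi hJ
  rcases le_or_gt n (a + 1) with han | han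
  · have := h.initial_of_long hn han hab he hs hsn hes (ho (by omega)) hi hx0 hy0 hyn hxy
    omega
  have hJ := hJ (by omega)
  -- The value a = -1 belongs to the initial square (0, 0), which the bounds on e and s exclude
  -- because n ≥ 3.
  have ha0 : 0 ≤ a := by omega
  have ho := ho ha0
  -- By `hJ`, the first case forces s = 0, so the excess lies in the other coordinate; equality
  -- forces s = 0 and a = n - 2.
  rcases lt_trichotomy (a + 2 + s) n with hx | hx | hx
  · have hJ' : s = 0 ∧ e ≤ m := by omega
    rcases h.transpose.initial_of_excess (by omega) hn ha0 (by omega) (by omega) hs he hJ'.2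
      (by omega) (by omega) ho.transpose hi.transpose hy0 hyn hx0 hxm (by omega) with h₁ | h₁ | h₁
    · right; left; clear hJ hxy; omega
    · right; right; right; left; clear hJ hxy; omega
    · right; right; left; clear hJ hxy; omega
  · obtain rfl : s = 0 := by omega
    rcases h.initial_of_tight hn hnm (by omega) hab (by omega) ho hi hx0 hxm hy0 hyn hxy with h₁ | h₁ | h₁ | h₁ | h₁ | h₁
    · left; clear hJ hxy; omega
    · right; left; clear hJ hxy; omega
    · clear hJ hxy; omega
    · clear hJ hxy; omega
    · right; right; right; left; clear hJ hxy; omega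
    · right; right; left; clear hJ hxy; omega
  · rcases h.initial_of_excess hn (by omega) ha0 (by omega) (by omega) he hs hsn hes hx ho hi hx0
      hxm hy0 hyn hxy with h₁ | h₁ | h₁
    · left; omega
    · right; right; right; right; right; clear hxy; omega
    · right; right; right; right; left; clear hxy; omega

end Initial

/-! ### From a list of squares to its precedence order. -/

section Path

variable {m n : ℕ}

/-- The coordinates of the square east of a given one. -/
theorem east_coord (σ : Square m n) :
    (((σ.1 : ℕ) : ℤ) + 1 < m ∧ (((east σ).1 : ℕ) : ℤ) = (σ.1 : ℕ) + 1 ∧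
        (((east σ).2 : ℕ) : ℤ) = (σ.2 : ℕ)) ∨
      (((σ.1 : ℕ) : ℤ) + 1 = m ∧ (((east σ).1 : ℕ) : ℤ) = 0 ∧
        (((east σ).2 : ℕ) : ℤ) = n - 1 - (σ.2 : ℕ)) := by
  have h₁ := σ.1.isLt
  have h₂ := σ.2.isLt
  unfold east
  split
  · left; refine ⟨by omega, by push_cast; rfl, rfl⟩
  · right; refine ⟨by omega, rfl, ?_⟩
    rw [Fin.val_rev]; omega

/-- The coordinates of the square north of a given one. -/
theorem north_coord (σ : Square m n) :
    (((σ.2 : ℕ) : ℤ) + 1 < n ∧ (((north σ).2 : ℕ) : ℤ) = (σ.2 : ℕ) + 1 ∧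
        (((north σ).1 : ℕ) : ℤ) = (σ.1 : ℕ)) ∨
      (((σ.2 : ℕ) : ℤ) + 1 = n ∧ (((north σ).2 : ℕ) : ℤ) = 0 ∧
        (((north σ).1 : ℕ) : ℤ) = m - 1 - (σ.1 : ℕ)) := by
  have h₁ := σ.1.isLt
  have h₂ := σ.2.isLt
  unfold north
  split
  · left; refine ⟨by omega, by push_cast; rfl, rfl⟩
  · right; refine ⟨by omega, rfl, ?_⟩
    rw [Fin.val_rev]; omega

theorem square_ext {σ τ : Square m n} (h₁ : ((σ.1 : ℕ) : ℤ) = (τ.1 : ℕ))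
    (h₂ : ((σ.2 : ℕ) : ℤ) = (τ.2 : ℕ)) : σ = τ :=
  Prod.ext (Fin.ext (by omega)) (Fin.ext (by omega))

/-- The `i`-th square of the list `l` is `(p, q)`. -/
def IsAt (l : List (Square m n)) (i : ℕ) (p q : ℤ) : Prop :=
  ∃ σ : Square m n, l[i]? = some σ ∧ ((σ.1 : ℕ) : ℤ) = p ∧ ((σ.2 : ℕ) : ℤ) = q

/-- The square `(p, q)` is followed in `l` by its image under `f`. -/
def Follows (l : List (Square m n)) (f : Square m n → Square m n) (p q : ℤ) : Prop :=
  ∃ (i : ℕ) (σ : Square m n), l[i]? = some σ ∧ l[i + 1]? = some (f σ) ∧ ((σ.1 : ℕ) : ℤ) = p ∧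
    ((σ.2 : ℕ) : ℤ) = q

/-- The square `(p, q)` is equal to `(p', q')` or comes before it in `l`. -/
def Precedes (l : List (Square m n)) (p q p' q' : ℤ) : Prop :=
  (p = p' ∧ q = q') ∨ ∃ i j : ℕ, i < j ∧ IsAt l i p q ∧ IsAt l j p' q'

theorem IsAt.index_eq {l : List (Square m n)} (hl : l.Nodup) {i j : ℕ} {p q : ℤ}
    (hi : IsAt l i p q) (hj : IsAt l j p q) : i = j := by
  obtain ⟨σ, h₁, h₂, h₃⟩ := hi
  obtain ⟨τ, h₄, h₅, h₆⟩ := hj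
  obtain rfl : σ = τ := square_ext (by omega) (by omega)
  obtain ⟨h₇, -⟩ := List.getElem?_eq_some_iff.1 h₁
  exact (List.getElem?_inj h₇ hl).1 (h₁.trans h₄.symm)

theorem Follows.precedes {l : List (Square m n)} {f : Square m n → Square m n} {p q p' q' : ℤ}
    (h : Follows l f p q)
    (hf : ∀ σ : Square m n, ((σ.1 : ℕ) : ℤ) = p → ((σ.2 : ℕ) : ℤ) = q →
      (((f σ).1 : ℕ) : ℤ) = p' ∧ (((f σ).2 : ℕ) : ℤ) = q') : Precedes l p q p' q' := by
  obtain ⟨i, σ, h₁, h₂, h₃, h₄⟩ := h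
  exact Or.inr ⟨i, i + 1, i.lt_succ_self, ⟨σ, h₁, h₃, h₄⟩, ⟨f σ, h₂, hf σ h₃ h₄⟩⟩

theorem IsHamiltonianPath.exists_pred {l : List (Square m n)}
    (hl : IsHamiltonianPath (board m n) l) {ι : Square m n} (hι : l.head? = some ι) {p q : ℤ}
    (hp : 0 ≤ p) (hpm : p < m) (hq : 0 ≤ q) (hqn : q < n)
    (hne : (((ι.1 : ℕ) : ℤ) = p → ((ι.2 : ℕ) : ℤ) ≠ q)) :
    ∃ p' q' : ℤ, 0 ≤ p' ∧ p' < m ∧ 0 ≤ q' ∧ q' < n ∧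
      (Follows l east p' q' ∧
          (p = p' + 1 ∧ q = q' ∨ p' + 1 = m ∧ p = 0 ∧ q = n - 1 - q') ∨
        Follows l north p' q' ∧
          (q = q' + 1 ∧ p = p' ∨ q' + 1 = n ∧ q = 0 ∧ p = m - 1 - p')) := by
  lift p to ℕ using hp
  lift q to ℕ using hq
  obtain ⟨j, hj, hjl⟩ := List.mem_iff_getElem.1
    (hl.mem (⟨p, by omega⟩, ⟨q, by omega⟩))
  cases j with
  | zero =>
    rw [List.head?_eq_getElem?, List.getElem?_eq_getElem hj, hjl, Option.some_inj] at hι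
    subst hι
    exact absurd rfl (hne rfl)
  | succ i =>
    obtain ⟨σ, hσ⟩ : ∃ σ, σ = l[i] := ⟨_, rfl⟩
    have hstep := List.isChain_iff_getElem.1 hl.isChain i hj
    rw [hjl, ← hσ] at hstep
    have hi : l[i]? = some σ := by rw [List.getElem?_eq_getElem (by omega), hσ]
    have hi' := List.getElem?_eq_getElem hj
    rw [hjl] at hi'
    have b₁ := σ.1.isLt
    have b₂ := σ.2.isLt
    refine ⟨(σ.1 : ℕ), (σ.2 : ℕ), by omega, by omega, by omega, by omega, ?_⟩
    rcases hstep with h | h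
    · left
      refine ⟨⟨i, σ, hi, by rw [hi', h], rfl, rfl⟩, ?_⟩
      have := east_coord σ
      rw [← h] at this
      simp only at this
      omega
    · right
      refine ⟨⟨i, σ, hi, by rw [hi', h], rfl, rfl⟩, ?_⟩
      have := north_coord σ
      rw [← h] at this
      simp only at this
      omega

/-- Precedence is antisymmetric because no square repeats, and the covering conditions say that
every square but the first has a predecessor. Both steps from a square agree only at the corner. -/
theorem IsHamiltonianPath.coveringRoute {l : List (Square m n)}
    (hl : IsHamiltonianPath (board m n) l) {ι : Square m n} (hι : l.head? = some ι)
    (hm : 2 ≤ m) (hn : 2 ≤ n) :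
    CoveringRoute m n (ι.1 : ℕ) (ι.2 : ℕ) (Follows l east) (Follows l north) (Precedes l) where
  refl h₁ h₂ := Or.inl ⟨h₁, h₂⟩
  trans := by
    rintro p q p' q' p'' q'' (⟨rfl, rfl⟩ | ⟨i, j, hij, hi, hj⟩) h₂
    · exact h₂
    rcases h₂ with ⟨rfl, rfl⟩ | ⟨j', k, hjk, hj', hk⟩
    · exact Or.inr ⟨i, j, hij, hi, hj⟩
    · obtain rfl := hj.index_eq hl.nodup hj'
      exact Or.inr ⟨i, k, hij.trans hjk, hi, hk⟩
  east h h₁ h₂ h₃ h₄ h₅ h₆ := h.precedes fun σ g₁ g₂ => by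
    have := east_coord σ; omega
  eastWrap h h₁ h₂ h₃ h₄ h₅ := h.precedes fun σ g₁ g₂ => by
    have := east_coord σ; omega
  north h h₁ h₂ h₃ h₄ h₅ h₆ := h.precedes fun σ g₁ g₂ => by
    have := north_coord σ; omega
  northWrap h h₁ h₂ h₃ h₄ h₅ := h.precedes fun σ g₁ g₂ => by
    have := north_coord σ; omega
  antisymm := by
    rintro p q p' q' (h | ⟨i, j, hij, hi, hj⟩) h₂
    · exact h
    rcases h₂ with ⟨rfl, rfl⟩ | ⟨j', i', hji, hj', hi'⟩
    · exact ⟨rfl, rfl⟩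
    · have h₁ := hi.index_eq hl.nodup hi'
      have h₂ := hj.index_eq hl.nodup hj'
      omega
  excl := by
    rintro p q ⟨i, σ, h₁, h₂, h₃, h₄⟩ ⟨j, τ, h₅, h₆, h₇, h₈⟩
    obtain rfl := IsAt.index_eq hl.nodup ⟨σ, h₁, h₃, h₄⟩ ⟨τ, h₅, h₇, h₈⟩
    obtain rfl : σ = τ := by rw [h₁] at h₅; exact Option.some_inj.1 h₅
    have h : east σ = north σ := by rw [h₂] at h₆; exact Option.some_inj.1 h₆
    have e₁ := east_coord σ
    have e₂ := north_coord σ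
    rw [h] at e₁
    have := σ.1.isLt
    have := σ.2.isLt
    omega
  cover := by
    intro p q h₁ h₂ h₃ h₄ h₅
    obtain ⟨p', q', g₁, g₂, g₃, g₄, ⟨hE, hE'⟩ | ⟨hN, hN'⟩⟩ := hl.exists_pred hι (p := p + 1)
      (q := q + 1) (by omega) (by omega) (by omega) (by omega) (by omega)
    · left; convert hE using 1 <;> omega
    · right; convert hN using 1 <;> omega
  coverLeft := by
    intro q h₃ h₄ h₅
    obtain ⟨p', q', g₁, g₂, g₃, g₄, ⟨hE, hE'⟩ | ⟨hN, hN'⟩⟩ := hl.exists_pred hι (p := 0)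
      (q := q + 1) (by omega) (by omega) (by omega) (by omega) (by omega)
    · left; convert hE using 1 <;> omega
    · right; convert hN using 1 <;> omega
  coverBottom := by
    intro p h₁ h₂ h₅
    obtain ⟨p', q', g₁, g₂, g₃, g₄, ⟨hE, hE'⟩ | ⟨hN, hN'⟩⟩ := hl.exists_pred hι (p := p + 1)
      (q := 0) (by omega) (by omega) (by omega) (by omega) (by omega)
    · left; convert hE using 1 <;> omega
    · right; convert hN using 1 <;> omega
  coverCorner := by
    intro h₅
    obtain ⟨p', q', g₁, g₂, g₃, g₄, ⟨hE, hE'⟩ | ⟨hN, hN'⟩⟩ := hl.exists_pred hι (p := 0)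
      (q := 0) (by omega) (by omega) (by omega) (by omega) (by omega)
    · left; convert hE using 1 <;> omega
    · right; convert hN using 1 <;> omega

end Path

/-! ### From a direction pattern to a hamiltonian path. -/

/-- A hamiltonian path obtained by cutting open a permutation at a vertex that every orbit meets. -/
theorem exists_hamiltonianPath_of_iterate {V : Type*} {G : Digraph V} {f : V → V}
    (hf : Function.Injective f) {τ ι : V} (hτ : f τ = ι) (hreach : ∀ v, ∃ k, f^[k] v = τ)
    (hadj : ∀ v, v ≠ τ → G.Adj v (f v)) :
    ∃ l : List V, IsHamiltonianPath G l ∧ l.head? = some ι := by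
  classical
  obtain ⟨d, hd, hmin⟩ : ∃ d, f^[d] ι = τ ∧ ∀ k < d, f^[k] ι ≠ τ :=
    ⟨Nat.find (hreach ι), Nat.find_spec (hreach ι), fun k hk => Nat.find_min (hreach ι) hk⟩
  refine ⟨(List.range (d + 1)).map fun k => f^[k] ι, ⟨?_, ?_, ?_⟩, by simp [List.range_succ_eq_map]⟩
  · rw [List.isChain_iff_getElem]
    intro i hi
    simp only [List.length_map, List.length_range] at hi
    simp only [List.getElem_map, List.getElem_range, Function.iterate_succ_apply']
    exact hadj _ (hmin i (by omega))
  · refine List.Nodup.map_on ?_ List.nodup_range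
    have key : ∀ i j, i < j → j ≤ d → f^[i] ι ≠ f^[j] ι := fun i j hij hj h => by
      obtain ⟨c, rfl⟩ := Nat.exists_eq_add_of_lt hij
      rw [show i + c + 1 = i + (c + 1) by ring, Function.iterate_add_apply] at h
      -- A repetition makes `ι` periodic with period at most d, so `τ` would be met before time d.
      have h₁ : f^[c + 1] ι = ι := (hf.iterate i h).symm
      refine hmin (d - (c + 1)) (by omega) ?_
      conv_lhs => rw [← h₁]
      rw [← Function.iterate_add_apply, Nat.sub_add_cancel (by omega), hd]
    intro i hi j hj h
    rw [List.mem_range] at hi hj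
    rcases lt_trichotomy i j with hij | hij | hij
    · exact absurd h (key i j hij (by omega))
    · exact hij
    · exact absurd h.symm (key j i hij (by omega))
  · have back : ∀ k v, f^[k] v = τ → ∃ i ≤ d, f^[i] ι = v := by
      intro k
      induction k with
      | zero => exact fun v hv => ⟨d, le_rfl, hd.trans hv.symm⟩
      | succ k ih =>
        intro v hv
        obtain ⟨i, hi, hiv⟩ := ih (f v) (by rwa [← Function.iterate_succ_apply])
        cases i with
        | zero => exact ⟨d, le_rfl, hf (by rw [hd, hτ]; exact hiv)⟩
        | succ i =>
          rw [Function.iterate_succ_apply'] at hiv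
          exact ⟨i, by omega, hf hiv⟩
    intro v
    obtain ⟨k, hk⟩ := hreach v
    obtain ⟨i, hi, hiv⟩ := back k v hk
    exact List.mem_map.2 ⟨i, List.mem_range.2 (by omega), hiv⟩

/-- A rule for leaving the squares, other than the terminal square `(u, v)`, of the projective
checkerboard so that no two squares lead to the same one and none leads to `(x, y)`. -/
structure Pattern (m n x y u v : ℤ) (E N : ℤ → ℤ → Prop) : Prop where
  total : ∀ p q, 0 ≤ p → p < m → 0 ≤ q → q < n → (p = u → q ≠ v) → E p q ∨ N p q
  excl : ∀ p q, E p q → N p q → False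
  halt : ¬ E u v ∧ ¬ N u v
  inner : ∀ p q, 0 ≤ p → p + 1 < m → 0 ≤ q → q + 1 < n → E p (q + 1) → N (p + 1) q → False
  innerE : ∀ p q, 0 ≤ p → p + 1 < m → 0 ≤ q → q < n → E p q → x = p + 1 → y = q → False
  innerN : ∀ p q, 0 ≤ p → p < m → 0 ≤ q → q + 1 < n → N p q → x = p → y = q + 1 → False
  left : ∀ q, 0 ≤ q → q + 1 < n → E (m - 1) (n - 2 - q) → N 0 q → False
  leftE : ∀ q, 0 ≤ q → q < n → E (m - 1) q → x = 0 → y = n - 1 - q → False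
  bottom : ∀ p, 0 ≤ p → p + 1 < m → E p 0 → N (m - 2 - p) (n - 1) → False
  bottomN : ∀ p, 0 ≤ p → p < m → N p (n - 1) → x = m - 1 - p → y = 0 → False

/-- The pattern, closed up by sending the terminal square to `ι`, is an injective map. Reachability
is required for every `Route`, so that it can be applied to the relation of being joined by iterates
of this map. -/
theorem Pattern.exists_hamiltonianPath {m n : ℕ} {u v : ℤ} {E N : ℤ → ℤ → Prop}
    {ι : Square m n} (h : Pattern m n (ι.1 : ℕ) (ι.2 : ℕ) u v E N)
    (hu : 0 ≤ u) (hum : u < m) (hv : 0 ≤ v) (hvn : v < n)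
    (hQ : ∀ Q, Route m n E N Q → ∀ p q : ℤ, 0 ≤ p → p < m → 0 ≤ q → q < n → Q p q u v) :
    ∃ l : List (Square m n), IsHamiltonianPath (board m n) l ∧ l.head? = some ι := by
  classical
  lift u to ℕ using hu
  lift v to ℕ using hv
  obtain ⟨τ, hτ⟩ : ∃ τ : Square m n, τ = (⟨u, by omega⟩, ⟨v, by omega⟩) := ⟨_, rfl⟩
  have hτ₁ : ((τ.1 : ℕ) : ℤ) = u := by rw [hτ]
  have hτ₂ : ((τ.2 : ℕ) : ℤ) = v := by rw [hτ]
  obtain ⟨f, hf⟩ : ∃ f : Square m n → Square m n, f = fun σ =>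
    if σ = τ then ι else if N (σ.1 : ℕ) (σ.2 : ℕ) then north σ else east σ := ⟨_, rfl⟩
  have fτ : f τ = ι := by rw [hf]; exact if_pos rfl
  have fN : ∀ σ : Square m n, σ ≠ τ → N (σ.1 : ℕ) (σ.2 : ℕ) → f σ = north σ := fun σ h₁ h₂ => by
    rw [hf]; dsimp only; rw [if_neg h₁, if_pos h₂]
  have fE : ∀ σ : Square m n, σ ≠ τ → ¬ N (σ.1 : ℕ) (σ.2 : ℕ) → f σ = east σ := fun σ h₁ h₂ => by
    rw [hf]; dsimp only; rw [if_neg h₁, if_neg h₂]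
  have hE : ∀ σ : Square m n, σ ≠ τ → ¬ N (σ.1 : ℕ) (σ.2 : ℕ) → E (σ.1 : ℕ) (σ.2 : ℕ) := by
    intro σ h₁ h₂
    have b₁ := σ.1.isLt
    have b₂ := σ.2.isLt
    refine (h.total _ _ (by omega) (by omega) (by omega) (by omega) fun h₃ h₄ => ?_).resolve_right
      h₂
    exact h₁ (square_ext (by omega) (by omega))
  have hEN : ∀ σ σ' : Square m n, E (σ.1 : ℕ) (σ.2 : ℕ) → N (σ'.1 : ℕ) (σ'.2 : ℕ) →
      east σ ≠ north σ' := by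
    intro σ σ' h₁ h₂ h₃
    have b₁ := σ.1.isLt
    have b₂ := σ.2.isLt
    have b₃ := σ'.1.isLt
    have b₄ := σ'.2.isLt
    have c₂ := north_coord σ'
    rw [← h₃] at c₂
    rcases east_coord σ with ⟨c₁, c₃, c₄⟩ | ⟨c₁, c₃, c₄⟩ <;>
      rcases c₂ with ⟨d₁, d₂, d₃⟩ | ⟨d₁, d₂, d₃⟩
    · refine h.inner (σ.1 : ℕ) (σ'.2 : ℕ) (by omega) (by omega) (by omega) (by omega) ?_ ?_
      · convert h₁ using 1; omega
      · convert h₂ using 1; omega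
    · refine h.bottom (σ.1 : ℕ) (by omega) (by omega) ?_ ?_
      · convert h₁ using 1; omega
      · convert h₂ using 1 <;> omega
    · refine h.left (σ'.2 : ℕ) (by omega) (by omega) ?_ ?_
      · convert h₁ using 1 <;> omega
      · convert h₂ using 1; omega
    -- Two wrapping steps meet only at (0, 0), and then both leave the corner (m - 1, n - 1).
    · refine h.excl _ _ h₁ ?_
      convert h₂ using 1 <;> omega
  have hιE : ∀ σ : Square m n, E (σ.1 : ℕ) (σ.2 : ℕ) → east σ ≠ ι := by
    intro σ h₁ h₃
    have b₁ := σ.1.isLt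
    have b₂ := σ.2.isLt
    rcases east_coord σ with ⟨c₁, c₃, c₄⟩ | ⟨c₁, c₃, c₄⟩ <;> rw [h₃] at c₃ c₄
    · exact h.innerE _ _ (by omega) (by omega) (by omega) (by omega) h₁ c₃ c₄
    · refine h.leftE (σ.2 : ℕ) (by omega) (by omega) ?_ c₃ c₄
      convert h₁ using 1; omega
  have hιN : ∀ σ : Square m n, N (σ.1 : ℕ) (σ.2 : ℕ) → north σ ≠ ι := by
    intro σ h₁ h₃
    have b₁ := σ.1.isLt
    have b₂ := σ.2.isLt
    rcases north_coord σ with ⟨c₁, c₃, c₄⟩ | ⟨c₁, c₃, c₄⟩ <;> rw [h₃] at c₃ c₄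
    · exact h.innerN _ _ (by omega) (by omega) (by omega) (by omega) h₁ c₄ c₃
    · refine h.bottomN (σ.1 : ℕ) (by omega) (by omega) ?_ c₄ c₃
      convert h₁ using 1; omega
  have heast : Function.Injective (east : Square m n → Square m n) := by
    intro σ σ' h₁
    have b₁ := σ.1.isLt
    have b₃ := σ'.1.isLt
    have c₁ := east_coord σ
    have c₂ := east_coord σ'
    rw [h₁] at c₁
    exact square_ext (by omega) (by omega)
  have hnorth : Function.Injective (north : Square m n → Square m n) := by
    intro σ σ' h₁
    have b₁ := σ.2.isLt
    have b₃ := σ'.2.isLt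
    have c₁ := north_coord σ
    have c₂ := north_coord σ'
    rw [h₁] at c₁
    exact square_ext (by omega) (by omega)
  refine exists_hamiltonianPath_of_iterate (f := f) (τ := τ) ?_ fτ ?_ ?_
  · intro σ σ' h₁
    by_cases hσ : σ = τ <;> by_cases hσ' : σ' = τ
    · rw [hσ, hσ']
    · rw [hσ, fτ] at h₁
      by_cases hN' : N (σ'.1 : ℕ) (σ'.2 : ℕ)
      · rw [fN _ hσ' hN'] at h₁
        exact absurd h₁.symm (hιN _ hN')
      · rw [fE _ hσ' hN'] at h₁
        exact absurd h₁.symm (hιE _ (hE _ hσ' hN'))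
    · rw [hσ', fτ] at h₁
      by_cases hN' : N (σ.1 : ℕ) (σ.2 : ℕ)
      · rw [fN _ hσ hN'] at h₁
        exact absurd h₁ (hιN _ hN')
      · rw [fE _ hσ hN'] at h₁
        exact absurd h₁ (hιE _ (hE _ hσ hN'))
    · by_cases hN : N (σ.1 : ℕ) (σ.2 : ℕ) <;> by_cases hN' : N (σ'.1 : ℕ) (σ'.2 : ℕ)
      · rw [fN _ hσ hN, fN _ hσ' hN'] at h₁
        exact hnorth h₁
      · rw [fN _ hσ hN, fE _ hσ' hN'] at h₁
        exact absurd h₁.symm (hEN _ _ (hE _ hσ' hN') hN)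
      · rw [fE _ hσ hN, fN _ hσ' hN'] at h₁
        exact absurd h₁ (hEN _ _ (hE _ hσ hN) hN')
      · rw [fE _ hσ hN, fE _ hσ' hN'] at h₁
        exact heast h₁
  · have hroute : Route m n E N fun p q p' q' => ∀ σ : Square m n, ((σ.1 : ℕ) : ℤ) = p →
        ((σ.2 : ℕ) : ℤ) = q → ∃ k, (((f^[k] σ).1 : ℕ) : ℤ) = p' ∧
          (((f^[k] σ).2 : ℕ) : ℤ) = q' := by
      have stepE : ∀ σ : Square m n, E (σ.1 : ℕ) (σ.2 : ℕ) → f^[1] σ = east σ := fun σ h₁ => by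
        refine fE σ (fun h₂ => h.halt.1 ?_) fun h₂ => h.excl _ _ h₁ h₂
        rwa [h₂, hτ₁, hτ₂] at h₁
      have stepN : ∀ σ : Square m n, N (σ.1 : ℕ) (σ.2 : ℕ) → f^[1] σ = north σ := fun σ h₁ => by
        refine fN σ (fun h₂ => h.halt.2 ?_) h₁
        rwa [h₂, hτ₁, hτ₂] at h₁
      constructor
      · rintro p q p' q' rfl rfl σ h₁ h₂
        exact ⟨0, h₁, h₂⟩
      · intro p q p' q' p'' q'' h₁ h₂ σ h₃ h₄
        obtain ⟨k, h₅, h₆⟩ := h₁ σ h₃ h₄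
        obtain ⟨k', h₇, h₈⟩ := h₂ _ h₅ h₆
        rw [← Function.iterate_add_apply] at h₇ h₈
        exact ⟨k' + k, h₇, h₈⟩
      · rintro p q p' q' h₁ h₂ h₃ h₄ h₅ h₆ h₇ σ rfl rfl
        refine ⟨1, ?_⟩
        rw [stepE σ h₁]
        have := east_coord σ
        omega
      · rintro p q p' q' h₁ h₂ h₃ h₄ h₅ h₆ σ rfl rfl
        refine ⟨1, ?_⟩
        rw [stepE σ h₁]
        have := east_coord σ
        omega
      · rintro p q p' q' h₁ h₂ h₃ h₄ h₅ h₆ h₇ σ rfl rfl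
        refine ⟨1, ?_⟩
        rw [stepN σ h₁]
        have := north_coord σ
        omega
      · rintro p q p' q' h₁ h₂ h₃ h₄ h₅ h₆ σ rfl rfl
        refine ⟨1, ?_⟩
        rw [stepN σ h₁]
        have := north_coord σ
        omega
    intro σ
    have b₁ := σ.1.isLt
    have b₂ := σ.2.isLt
    obtain ⟨k, hk₁, hk₂⟩ := hQ _ hroute (σ.1 : ℕ) (σ.2 : ℕ) (by omega) (by omega) (by omega)
      (by omega) σ rfl rfl
    exact ⟨k, square_ext (by omega) (by omega)⟩
  · intro σ hσ
    by_cases hN : N (σ.1 : ℕ) (σ.2 : ℕ)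
    · exact Or.inr (fN _ hσ hN)
    · exact Or.inl (fE _ hσ hN)

theorem Route.run {m n : ℤ} {E N : ℤ → ℤ → Prop} {Q : ℤ → ℤ → ℤ → ℤ → Prop}
    (h : Route m n E N Q) {p p' q : ℤ} (hp : 0 ≤ p) (hpp : p ≤ p') (hp' : p' < m) (hq : 0 ≤ q)
    (hqn : q < n) (hE : ∀ r, p ≤ r → r < p' → E r q) : Q p q p' q := by
  induction p', hpp using Int.leInduction with
  | base => exact h.refl rfl rfl
  | succ r hr ih =>
    refine h.trans (ih (by omega) fun t h₁ h₂ => hE t h₁ (by omega)) ?_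
    exact h.east (hE r hr (by omega)) (by omega) hp' hq hqn rfl rfl

theorem Route.runWrap {m n : ℤ} {E N : ℤ → ℤ → Prop} {Q : ℤ → ℤ → ℤ → ℤ → Prop}
    (h : Route m n E N Q) {p q : ℤ} (hp : 0 ≤ p) (hpm : p < m) (hq : 0 ≤ q)
    (hqn : q < n) (hE : ∀ r, p ≤ r → r < m → E r q) : Q p q 0 (n - 1 - q) :=
  h.trans (h.run hp (p' := m - 1) (by omega) (by omega) hq hqn fun r h₁ h₂ =>
      hE r h₁ (by omega))
    (h.eastWrap (hE (m - 1) (by omega) (by omega)) (by omega) hq hqn rfl rfl)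

/-! ### Sufficiency: patterns traced row by row from the first column. -/

section Rows

variable {m n : ℕ} {ι : Square m n}

/-- Paths starting on the bottom row. -/
theorem exists_path_of_bottom (hn : 3 ≤ n) (hp : (n - 1) / 2 < (ι.1 : ℕ)) (hq : (ι.2 : ℕ) = 0) :
    ∃ l : List (Square m n), IsHamiltonianPath (board m n) l ∧ l.head? = some ι := by
  obtain ⟨j, hj⟩ : ∃ j : ℤ, j = ((n : ℤ) - 1) / 2 := ⟨_, rfl⟩
  obtain ⟨d, hd⟩ : ∃ d : ℤ, d = (ι.1 : ℕ) - 1 := ⟨_, rfl⟩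
  have hι := ι.1.isLt
  have hjd : j ≤ d := by omega
  have hdm : d + 2 ≤ m := by omega
  refine Pattern.exists_hamiltonianPath (u := d - j) (v := j)
    (E := fun p q => ¬ (p + q = d ∧ q ≤ j)) (N := fun p q => p + q = d ∧ q < j)
    ⟨?_, ?_, ?_, ?_, ?_, ?_, ?_, ?_, ?_, ?_⟩ (by omega) (by omega) (by omega) (by omega) ?_
  any_goals intros; omega
  intro Q h
  have past : ∀ p q : ℤ, 0 ≤ p → p < m → 0 ≤ q → q < n → (d < p + q ∨ j < q) →
      Q p q 0 (n - 1 - q) := fun p q h₁ h₂ h₃ h₄ h₅ =>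
    h.runWrap h₁ h₂ h₃ h₄ fun r _ _ => by omega
  have low : ∀ p q : ℤ, 0 ≤ p → 0 ≤ q → q < j → p + q ≤ d → Q p q 0 (n - 2 - q) :=
      fun p q h₁ h₃ h₄ h₅ => by
    refine h.trans (h.run h₁ (p' := d - q) (by omega) (by omega) h₃ (by omega) fun r _ _ => by
      omega) ?_
    refine h.trans (h.north (p' := d - q) (q' := q + 1) ?_ ?_ ?_ ?_ ?_ rfl rfl) ?_ <;> try omega
    convert past (d - q) (q + 1) (by omega) (by omega) (by omega) (by omega) (by omega) using 1
    ring
  have last : ∀ p : ℤ, 0 ≤ p → p + j ≤ d → Q p j (d - j) j := fun p h₁ h₂ =>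
    h.run h₁ (by omega) (by omega) (by omega) (by omega) fun r _ _ => by omega
  -- At column 0, row q < j goes to n - 2 - q and then, unless this is already j, to q + 1; so the
  -- rows climb to the terminal row j.
  have rows : ∀ k : ℕ, k ≤ j → Q 0 (j - k) (d - j) j := by
    intro k
    induction k with
    | zero => intro _; simpa using last 0 le_rfl (by omega)
    | succ k ih =>
      intro hk
      have ih := ih (by push_cast at hk; omega)
      push_cast at *
      have h₁ := low 0 (j - (k + 1)) le_rfl (by omega) (by omega) (by omega)
      refine h.trans h₁ ?_
      by_cases hc : (n : ℤ) - 2 - (j - (k + 1)) = j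
      · rw [hc]
        exact last 0 le_rfl (by omega)
      · refine h.trans (past 0 _ le_rfl (by omega) (by omega) (by omega) (by omega)) ?_
        convert ih using 1
        ring
  have rows' : ∀ q : ℤ, 0 ≤ q → q < n → Q 0 q (d - j) j := by
    have h₁ : ∀ q : ℤ, 0 ≤ q → q ≤ j → Q 0 q (d - j) j := fun q h₁ h₂ => by
      have := rows (j - q).toNat (by omega)
      rwa [show j - ((j - q).toNat : ℤ) = q by omega] at this
    intro q h₂ h₃
    rcases le_or_gt q j with h₄ | h₄
    · exact h₁ q h₂ h₄
    · exact h.trans (past 0 q le_rfl (by omega) h₂ h₃ (by omega)) (h₁ _ (by omega) (by omega))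
  intro p q h₁ h₂ h₃ h₄
  by_cases hc : d < p + q ∨ j < q
  · exact h.trans (past p q h₁ h₂ h₃ h₄ hc) (rows' _ (by omega) (by omega))
  · by_cases hc' : q = j
    · rw [hc']
      exact last p h₁ (by omega)
    · exact h.trans (low p q h₁ h₃ (by omega) (by omega)) (rows' _ (by omega) (by omega))

/-- Paths starting on row `n / 2`. -/
theorem exists_path_of_upper_middle (hn : 3 ≤ n) (hp : n ≤ (ι.1 : ℕ) + n / 2)
    (hq : (ι.2 : ℕ) = n / 2) :
    ∃ l : List (Square m n), IsHamiltonianPath (board m n) l ∧ l.head? = some ι := by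
  obtain ⟨h', hh⟩ : ∃ j : ℤ, j = (n : ℤ) / 2 := ⟨_, rfl⟩
  obtain ⟨d, hd⟩ : ∃ d : ℤ, d = (ι.1 : ℕ) - 1 + h' := ⟨_, rfl⟩
  have hι := ι.1.isLt
  refine Pattern.exists_hamiltonianPath (u := d - n + 1) (v := n - 1)
    (E := fun p q => ¬ (p + q = d ∧ h' ≤ q)) (N := fun p q => p + q = d ∧ h' ≤ q ∧ q + 1 < n)
    ⟨?_, ?_, ?_, ?_, ?_, ?_, ?_, ?_, ?_, ?_⟩ (by omega) (by omega) (by omega) (by omega) ?_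
  any_goals intros; omega
  intro Q h
  have past : ∀ p q : ℤ, 0 ≤ p → p < m → 0 ≤ q → q < n → (d < p + q ∨ q < h') →
      Q p q 0 (n - 1 - q) := fun p q h₁ h₂ h₃ h₄ h₅ =>
    h.runWrap h₁ h₂ h₃ h₄ fun r _ _ => by omega
  have low : ∀ p q : ℤ, 0 ≤ p → h' ≤ q → q + 1 < n → p + q ≤ d → Q p q 0 (n - 2 - q) :=
      fun p q h₁ h₃ h₄ h₅ => by
    refine h.trans (h.run h₁ (p' := d - q) (by omega) (by omega) (by omega) (by omega)
      fun r _ _ => by omega) ?_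
    refine h.trans (h.north (p' := d - q) (q' := q + 1) ?_ ?_ ?_ ?_ ?_ rfl rfl) ?_ <;> try omega
    convert past (d - q) (q + 1) (by omega) (by omega) (by omega) (by omega) (by omega) using 1
    ring
  have last : ∀ p : ℤ, 0 ≤ p → p + (n - 1) ≤ d → Q p (n - 1) (d - n + 1) (n - 1) :=
    fun p h₁ h₂ => h.run h₁ (by omega) (by omega) (by omega) (by omega) fun r _ _ => by omega
  -- At column 0, row q goes to n - 1 - q and then to q - 1; row 0 goes to the terminal row n - 1.
  have rows : ∀ k : ℕ, k < h' → Q 0 k (d - n + 1) (n - 1) := by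
    intro k
    induction k with
    | zero =>
      intro _
      have h₁ := past 0 0 le_rfl (by omega) le_rfl (by omega) (by omega)
      rw [sub_zero] at h₁
      exact h.trans h₁ (last 0 le_rfl (by omega))
    | succ k ih =>
      intro hk
      have ih := ih (by push_cast at hk; omega)
      push_cast at *
      refine h.trans (past 0 (k + 1) le_rfl (by omega) (by omega) (by omega) (by omega)) ?_
      refine h.trans (low 0 _ le_rfl (by omega) (by omega) (by omega)) ?_
      convert ih using 1
      ring
  have rows' : ∀ q : ℤ, 0 ≤ q → q < n → Q 0 q (d - n + 1) (n - 1) := by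
    have h₁ : ∀ q : ℤ, 0 ≤ q → q < h' → Q 0 q (d - n + 1) (n - 1) := fun q h₁ h₂ => by
      have := rows q.toNat (by omega)
      rwa [show (q.toNat : ℤ) = q by omega] at this
    intro q h₂ h₃
    rcases lt_or_ge q h' with h₄ | h₄
    · exact h₁ q h₂ h₄
    by_cases h₅ : q = n - 1
    · rw [h₅]; exact last 0 le_rfl (by omega)
    · exact h.trans (low 0 q le_rfl h₄ (by omega) (by omega)) (h₁ _ (by omega) (by omega))
  intro p q h₁ h₂ h₃ h₄
  by_cases hc : d < p + q ∨ q < h'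
  · exact h.trans (past p q h₁ h₂ h₃ h₄ hc) (rows' _ (by omega) (by omega))
  · by_cases hc' : q = n - 1
    · rw [hc']
      exact last p h₁ (by omega)
    · exact h.trans (low p q h₁ (by omega) (by omega) (by omega)) (rows' _ (by omega) (by omega))

/-- Paths starting on row `(n - 1) / 2`. -/
theorem exists_path_of_lower_middle (hn : 3 ≤ n) (hnm : n ≤ m) (hp : (ι.1 : ℕ) ≤ n / 2)
    (hq : (ι.2 : ℕ) = (n - 1) / 2) :
    ∃ l : List (Square m n), IsHamiltonianPath (board m n) l ∧ l.head? = some ι := by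
  obtain ⟨h', hh⟩ : ∃ j : ℤ, j = ((n : ℤ) - 1) / 2 := ⟨_, rfl⟩
  obtain ⟨a, ha⟩ : ∃ a : ℤ, a = (ι.1 : ℕ) - 1 + h' := ⟨_, rfl⟩
  have hι := ι.1.isLt
  have han : a + 2 ≤ n := by omega
  refine Pattern.exists_hamiltonianPath (u := m - 2 - a) (v := n - 1)
    (E := fun p q => ¬ (p + q = a ∧ h' ≤ q) ∧ p + q ≠ m + n - 3 - a)
    (N := fun p q => p + q = a ∧ h' ≤ q ∨ p + q = m + n - 3 - a ∧ q + 1 < n)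
    ⟨?_, ?_, ?_, ?_, ?_, ?_, ?_, ?_, ?_, ?_⟩ (by omega) (by omega) (by omega) (by omega) ?_
  any_goals intros; omega
  intro Q h
  have past : ∀ p q : ℤ, 0 ≤ p → p < m → 0 ≤ q → q < n → m + n - 3 - a < p + q →
      Q p q 0 (n - 1 - q) := fun p q h₁ h₂ h₃ h₄ h₅ =>
    h.runWrap h₁ h₂ h₃ h₄ fun r _ _ => by omega
  -- Rows below n - 2 - a do not meet the paired diagonal, so nothing interrupts the run east.
  have mid : ∀ p q : ℤ, 0 ≤ p → p < m → 0 ≤ q → q < n - 2 - a → a < p + q → Q p q 0 (n - 1 - q) :=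
    fun p q h₁ h₂ h₃ h₄ h₅ => h.runWrap h₁ h₂ h₃ (by omega) fun r _ _ => by omega
  have mid' : ∀ p q : ℤ, 0 ≤ p → p < m → n - 2 - a ≤ q → q + 1 < n → 0 ≤ q → a < p + q →
      p + q ≤ m + n - 3 - a → Q p q 0 (n - 2 - q) := fun p q h₁ h₂ h₃ h₄ h₅ h₆ h₇ => by
    refine h.trans (h.run h₁ (p' := m + n - 3 - a - q) (by omega) (by omega) (by omega) (by omega)
      fun r _ _ => by omega) ?_
    refine h.trans (h.north (p' := m + n - 3 - a - q) (q' := q + 1) ?_ ?_ ?_ ?_ ?_ rfl rfl) ?_ <;>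
      try omega
    convert past (m + n - 3 - a - q) (q + 1) (by omega) (by omega) (by omega) (by omega)
      (by omega) using 1
    ring
  have last : ∀ p : ℤ, 0 ≤ p → p + (n - 1) ≤ m + n - 3 - a → Q p (n - 1) (m - 2 - a) (n - 1) :=
    fun p h₁ h₂ => h.run h₁ (by omega) (by omega) (by omega) (by omega) fun r _ _ => by omega
  have low : ∀ p q : ℤ, 0 ≤ p → 0 ≤ q → p + q ≤ a → q < h' → Q p q (a + 1 - q) q :=
    fun p q h₁ h₂ h₃ h₄ => h.run h₁ (by omega) (by omega) (by omega) (by omega)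
      fun r _ _ => by omega
  have low' : ∀ p q : ℤ, 0 ≤ p → 0 ≤ q → p + q ≤ a → h' ≤ q → Q p q (a - q) (q + 1) :=
    fun p q h₁ h₂ h₃ h₄ => by
      refine h.trans (h.run h₁ (p' := a - q) (by omega) (by omega) (by omega) (by omega)
        fun r _ _ => by omega) ?_
      refine h.north ?_ ?_ ?_ ?_ ?_ rfl rfl <;> omega
  have high : ∀ q : ℤ, a < q → n - 2 - a ≤ q → q + 1 < n → Q 0 q 0 (n - 2 - q) :=
    fun q h₁ h₂ h₃ => mid' 0 q le_rfl (by omega) h₂ h₃ (by omega) (by omega) (by omega)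
  -- Two crossings of the board lower the row by one, until row 0 escapes to the terminal row.
  have down : ∀ q : ℤ, 0 ≤ q → q < h' → q = 0 ∧ Q 0 q (m - 2 - a) (n - 1) ∨
      0 < q ∧ Q 0 q 0 (q - 1) := by
    intro q h₁ h₂
    by_cases hc : q < n - 2 - a
    · have h₃ : Q 0 q 0 (n - 1 - q) := by
        by_cases h₄ : q ≤ a
        · exact h.trans (low 0 q le_rfl h₁ (by omega) h₂)
            (mid _ q (by omega) (by omega) h₁ hc (by omega))
        · exact mid 0 q le_rfl (by omega) h₁ hc (by omega)
      by_cases hq : q = 0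
      · left
        subst hq
        refine ⟨rfl, h.trans h₃ ?_⟩
        rw [sub_zero]
        exact last 0 le_rfl (by omega)
      · right
        refine ⟨by omega, h.trans h₃ ?_⟩
        convert high (n - 1 - q) (by omega) (by omega) (by omega) using 1
        ring
    · have h₃ : Q 0 q 0 (n - 2 - q) :=
        h.trans (low 0 q le_rfl h₁ (by omega) h₂)
          (mid' _ q (by omega) (by omega) (by omega) (by omega) h₁ (by omega) (by omega))
      have h₄ := h.trans h₃ (low' 0 (n - 2 - q) le_rfl (by omega) (by omega) (by omega))
      rw [show (n : ℤ) - 2 - q + 1 = n - 1 - q by ring] at h₄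
      by_cases hq : q = 0
      · left
        subst hq
        simp only [sub_zero] at h₄
        exact ⟨rfl, h.trans h₄ (last _ (by omega) (by omega))⟩
      · right
        refine ⟨by omega, h.trans h₄ ?_⟩
        convert mid' (a - (n - 2 - q)) (n - 1 - q) (by omega) (by omega) (by omega) (by omega) (by omega) (by omega)
          (by omega) using 1
        ring
  have rows : ∀ k : ℕ, k < h' → Q 0 k (m - 2 - a) (n - 1) := by
    intro k
    induction k with
    | zero =>
      intro hk
      rcases down 0 le_rfl (by omega) with h₁ | h₁
      · exact h₁.2
      · exact absurd h₁.1 (lt_irrefl 0)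
    | succ k ih =>
      intro hk
      have ih := ih (by push_cast at hk; omega)
      rcases down (k + 1 : ℕ) (by omega) hk with h₁ | h₁
      · omega
      · refine h.trans h₁.2 ?_
        convert ih using 1
        push_cast; ring
  have rows' : ∀ q : ℤ, 0 ≤ q → q < n → Q 0 q (m - 2 - a) (n - 1) := by
    have h₁ : ∀ q : ℤ, 0 ≤ q → q < h' → Q 0 q (m - 2 - a) (n - 1) := fun q h₁ h₂ => by
      have := rows q.toNat (by omega)
      rwa [show (q.toNat : ℤ) = q by omega] at this
    have h₂ : ∀ q : ℤ, a < q → n - 2 - a ≤ q → q < n → Q 0 q (m - 2 - a) (n - 1) :=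
        fun q h₂ h₃ h₄ => by
      by_cases h₅ : q = n - 1
      · rw [h₅]; exact last 0 le_rfl (by omega)
      · exact h.trans (high q h₂ h₃ (by omega)) (h₁ _ (by omega) (by omega))
    intro q h₃ h₄
    rcases lt_or_ge q h' with h₅ | h₅
    · exact h₁ q h₃ h₅
    rcases le_or_gt q a with h₆ | h₆
    · have h₇ := low' 0 q le_rfl h₃ (by omega) h₅
      by_cases h₈ : q + 1 = n - 1
      · rw [h₈] at h₇
        exact h.trans h₇ (last _ (by omega) (by omega))
      · exact h.trans h₇ (h.trans (mid' _ (q + 1) (by omega) (by omega) (by omega) (by omega)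
          (by omega) (by omega) (by omega)) (h₁ _ (by omega) (by omega)))
    · by_cases h₇ : q < n - 2 - a
      · exact h.trans (mid 0 q le_rfl (by omega) h₃ h₇ (by omega))
          (h₂ _ (by omega) (by omega) (by omega))
      · exact h₂ q h₆ (by omega) h₄
  have mids : ∀ p q : ℤ, 0 ≤ p → p < m → 0 ≤ q → q < n → a < p + q →
      Q p q (m - 2 - a) (n - 1) := fun p q h₁ h₂ h₃ h₄ h₅ => by
    by_cases h₆ : m + n - 3 - a < p + q
    · exact h.trans (past p q h₁ h₂ h₃ h₄ h₆) (rows' _ (by omega) (by omega))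
    by_cases h₇ : q < n - 2 - a
    · exact h.trans (mid p q h₁ h₂ h₃ h₇ h₅) (rows' _ (by omega) (by omega))
    by_cases h₈ : q = n - 1
    · rw [h₈]; exact last p h₁ (by omega)
    · exact h.trans (mid' p q h₁ h₂ (by omega) (by omega) h₃ h₅ (by omega))
        (rows' _ (by omega) (by omega))
  intro p q h₁ h₂ h₃ h₄
  by_cases h₅ : a < p + q
  · exact mids p q h₁ h₂ h₃ h₄ h₅
  · by_cases h₆ : q < h'
    · exact h.trans (low p q h₁ h₃ (by omega) h₆)
        (mids _ _ (by omega) (by omega) h₃ h₄ (by omega))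
    · exact h.trans (low' p q h₁ h₃ (by omega) (by omega))
        (mids _ _ (by omega) (by omega) (by omega) (by omega) (by omega))

end Rows

/-! ### Sufficiency: every square reaches the terminal one. -/

section Reach

variable {m n a k u v : ℤ} {E N : ℤ → ℤ → Prop} {Q : ℤ → ℤ → ℤ → ℤ → Prop}

/-- If the `k` inner diagonals next to the diagonal `a` travel north and the others east, then the
inner region has the expected flow and every square leaves it. -/
theorem Route.flow_of_zones (h : Route m n E N Q) (hn : 3 ≤ n) (hnm : n ≤ m) (ha : -1 ≤ a)
    (hk : n ≤ a + k + 2) (hs : 2 * k ≤ n ∨ m - 4 ≤ 2 * a)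
    (hN : ∀ i, a < i → i ≤ a + k → 2 * i ≤ m + n - 3 → HoldsOn m n N i)
    (hE : ∀ i, a + k < i → 2 * i ≤ m + n - 3 → HoldsOn m n E i) (t : ℕ)
    (ht : a ≤ (m + n - 4) / 2 - t) :
    ∃ e s : ℤ, 0 ≤ e ∧ 0 ≤ s ∧ e + s = m + n - 4 - 2 * ((m + n - 4) / 2 - t) ∧
      (a + k ≤ (m + n - 4) / 2 - t ∧ s = 0 ∨
        (m + n - 4) / 2 - t ≤ a + k ∧ 2 * (a + k) ≤ m + n - 4 ∧
          s = 2 * (a + k - ((m + n - 4) / 2 - t)) ∨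
        m + n - 4 ≤ 2 * (a + k) ∧ s = m + n - 4 - 2 * ((m + n - 4) / 2 - t)) ∧
      InnerFlow m n Q ((m + n - 4) / 2 - t) e s ∧ ExitFlow m n Q ((m + n - 4) / 2 - t) := by
  induction t with
  | zero =>
    simp only [Nat.cast_zero, sub_zero] at *
    rcases Int.emod_two_eq_zero_or_one (m + n) with hmod | hmod
    · exact ⟨0, 0, by omega, by omega, by omega, by omega,
        InnerFlow.of_adjacent h (by omega), ExitFlow.of_adjacent h (by omega)⟩
    · rcases le_or_gt ((m + n - 4) / 2 + 1) (a + k) with hc | hc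
      · have := hN ((m + n - 4) / 2 + 1) (by omega) hc (by omega)
        exact ⟨0, 1, by omega, by omega, by omega, by omega,
          InnerFlow.of_north h (by omega) this, ExitFlow.of_north h (by omega) this⟩
      · have := hE ((m + n - 4) / 2 + 1) hc (by omega)
        exact ⟨1, 0, by omega, by omega, by omega, by omega,
          InnerFlow.of_east h (by omega) this, ExitFlow.of_east h (by omega) this⟩
  | succ t ih =>
    obtain ⟨e, s, he, hs, hes, hse, hi, hx⟩ := ih (by push_cast at *; omega)
    clear ih
    have ht' : (m + n - 4) / 2 - (t + 1 : ℕ) = (m + n - 4) / 2 - t - 1 := by push_cast; ring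
    rw [ht'] at ht ⊢
    obtain ⟨i, hi'⟩ : ∃ i, i = (m + n - 4) / 2 - (t : ℤ) := ⟨_, rfl⟩
    rw [← hi'] at hes hi hx hse ht ⊢
    rcases le_or_gt i (a + k) with hc | hc
    -- The exit condition for north is where 2k ≤ n or m - 4 ≤ 2a enters; for the east diagonals it
    -- is vacuous, as i > a + k ≥ n - 2.
    · have := hN i (by omega) hc (by omega)
      exact ⟨e, s + 2, by omega, by omega, by omega, by omega,
        InnerFlow.north h this he hs hes hi,
        ExitFlow.north h this (by omega) he hs hes hi hx (by omega)⟩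
    · have := hE i hc (by omega)
      exact ⟨e + 2, s, by omega, by omega, by omega, by omega,
        InnerFlow.east h this he hs hes hi,
        ExitFlow.east h this (by omega) he hs hes hi hx (by omega)⟩

/-- If the outer diagonals travel east and the diagonal `a` leads to `(u, v)`, then so do the outer
squares. -/
theorem Route.outer_reach (h : Route m n E N Q) (ham : a < m)
    (hO : ∀ p q, 0 ≤ p → p < m → 0 ≤ q → q < n → (p + q < a ∨ m + n - 3 - a < p + q) → E p q)
    (hA : ∀ q, 0 ≤ q → q < n → q ≤ a → Q (a - q) q u v)
    {p q : ℤ} (hp : 0 ≤ p) (hpm : p < m) (hq : 0 ≤ q) (hqn : q < n)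
    (hpq : p + q ≤ a ∨ m + n - 3 - a < p + q) : Q p q u v := by
  have low : ∀ p q : ℤ, 0 ≤ p → 0 ≤ q → q < n → p + q ≤ a → Q p q u v := fun p q h₁ h₂ h₃ h₄ =>
    h.trans (h.run h₁ (p' := a - q) (by omega) (by omega) h₂ h₃ fun r _ _ =>
      hO r q (by omega) (by omega) h₂ h₃ (by omega)) (hA q h₂ h₃ (by omega))
  by_cases hc : p + q ≤ a
  · exact low p q hp hq hqn hc
  · exact h.trans (h.runWrap hp hpm hq hqn fun r _ _ =>
      hO r q (by omega) (by omega) hq hqn (by omega)) (low _ _ le_rfl (by omega) (by omega)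
        (by omega))

theorem Route.reach_of_diagonals (h : Route m n E N Q) (ham : a < m)
    (hO : ∀ p q, 0 ≤ p → p < m → 0 ≤ q → q < n → (p + q < a ∨ m + n - 3 - a < p + q) → E p q)
    (hA : ∀ q, 0 ≤ q → q < n → q ≤ a → Q (a - q) q u v)
    (hB : ∀ p q, 0 ≤ p → p < m → 0 ≤ q → q < n → p + q = m + n - 3 - a → Q p q u v)
    (hx : ExitFlow m n Q a) (p q : ℤ) (hp : 0 ≤ p) (hpm : p < m) (hq : 0 ≤ q) (hqn : q < n) :
    Q p q u v := by
  by_cases hc : p + q ≤ a ∨ m + n - 3 - a < p + q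
  · exact h.outer_reach ham hO hA hp hpm hq hqn hc
  · obtain ⟨p', q', h₁, h₂, h₃, h₄, h₅, h₆⟩ := hx p q hp hpm hq hqn (by omega) (by omega)
    exact h.trans h₆ (hB p' q' h₁ h₂ h₃ h₄ h₅)

theorem Route.outerFlow (h : Route m n E N Q) (hm : 1 ≤ m) (hn : 1 ≤ n) (ha : 0 ≤ a)
    (hab : 2 * a ≤ m + n - 2)
    (hO : ∀ p q, 0 ≤ p → p < m → 0 ≤ q → q < n → (p + q < a ∨ m + n - 3 - a < p + q) → E p q) :
    OuterFlow m n Q a := by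
  lift a to ℕ using ha
  refine OuterFlow.of_corner h ?_ a fun i h₁ h₂ => Or.inl fun p q g₁ g₂ g₃ g₄ g₅ =>
    hO p q g₁ g₂ g₃ g₄ (by omega)
  apply h.eastWrap (hO (m - 1) (n - 1) ?_ ?_ ?_ ?_ ?_) <;> omega

theorem Route.flows (h : Route m n E N Q) {s : ℤ} (hn : 3 ≤ n) (hnm : n ≤ m) (ha : 0 ≤ a)
    (hab : 2 * a < m + n - 3) (hk : n ≤ a + k + 2) (hk0 : 0 ≤ k)
    (hs : 2 * k ≤ m + n - 4 - 2 * a ∧ s = 2 * k ∨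
      2 * k = m + n - 3 - 2 * a ∧ s = m + n - 4 - 2 * a) (hsn : s ≤ n)
    (hO : ∀ p q, 0 ≤ p → p < m → 0 ≤ q → q < n → (p + q < a ∨ m + n - 3 - a < p + q) → E p q)
    (hZN : ∀ p q, 0 ≤ p → p < m → 0 ≤ q → q < n → (a < p + q ∧ p + q ≤ a + k ∨
      m + n - 3 - a - k ≤ p + q ∧ p + q < m + n - 3 - a) → N p q)
    (hZE : ∀ p q, 0 ≤ p → p < m → 0 ≤ q → q < n → a + k < p + q → p + q < m + n - 3 - a - k →
      E p q) :
    ∃ e, e + s = m + n - 4 - 2 * a ∧ 0 ≤ e ∧ OuterFlow m n Q a ∧ InnerFlow m n Q a e s ∧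
      ExitFlow m n Q a := by
  have ho := h.outerFlow (by omega) (by omega) ha (by omega) hO
  obtain ⟨t, ht⟩ : ∃ t : ℕ, (m + n - 4) / 2 - (t : ℤ) = a :=
    ⟨((m + n - 4) / 2 - a).toNat, by omega⟩
  obtain ⟨e, s', he, hs', hes, hse, hi, hx⟩ := h.flow_of_zones (a := a) (k := k) hn hnm (by omega)
    hk (by omega)
    (fun i h₁ h₂ h₃ p q g₁ g₂ g₃ g₄ g₅ => hZN p q g₁ g₂ g₃ g₄ (by omega))
    (fun i h₁ h₂ p q g₁ g₂ g₃ g₄ g₅ => hZE p q g₁ g₂ g₃ g₄ (by omega) (by omega)) t (by omega)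
  rw [ht] at hes hse hi hx
  obtain rfl : s = s' := by omega
  exact ⟨e, hes, he, ho, hi, hx⟩

/-- A row q < η goes to n - 1 - s - q and, if this is a row of reflection type, on to q - 1. Row 0
goes to n - 1 - s, where the half-turned rows begin; these climb one at a time to the terminal
square. -/
theorem Route.reach_of_lower (h : Route m n E N Q) {e s η : ℤ} (hn : 3 ≤ n) (ha : 0 ≤ a)
    (ham : a + 2 ≤ m) (he : 0 ≤ e) (hs : 0 ≤ s) (hsn : s ≤ n)
    (hes : e + s = m + n - 4 - 2 * a) (hx : n ≤ a + 2 + s)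
    (ho : OuterFlow m n Q a) (hi : InnerFlow m n Q a e s) (hη0 : 0 ≤ η) (hηa : η ≤ a + 1)
    (hη : n - s - 1 ≤ 2 * η) (hη' : 2 * η ≤ n - s)
    (huv : (n ≤ a + 1 ∧ u = a - n + 1 ∧ v = n - 1) ∨ (a + 2 ≤ n ∧ u = m - 1 ∧ v = n - 2 - a))
    (hAE : ∀ p q, 0 ≤ p → 0 ≤ q → q < n → q < η → p + q = a → E p q)
    (hAN : ∀ p q, 0 ≤ p → 0 ≤ q → q + 1 < n → η ≤ q → p + q = a → N p q)
    (hBE : ∀ p q, 0 ≤ p → p < m → 0 ≤ q → q < n → p + q = m + n - 3 - a → (p = u → q ≠ v) →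
      E p q)
    (q : ℤ) (hq0 : 0 ≤ q) (hqn : q < n) (hqa : q ≤ a) : Q (a - q) q u v := by
  have up : ∀ q, n - 1 - s ≤ q → η ≤ q → 0 ≤ q → q + 1 < n → q ≤ a →
      (q + 1 ≤ a ∧ Q (a - q) q (a - (q + 1)) (q + 1)) ∨ Q (a - q) q u v :=
        fun q h₁ h₂ h₃ h₄ h₅ => by
    have h1 : Q (a - q) q (a - q) (q + 1) := by
      refine h.north (hAN _ _ ?_ ?_ ?_ ?_ ?_) ?_ ?_ ?_ ?_ ?_ ?_ <;> omega
    have h2 : Q (a - q) (q + 1) (m - 1 - a + q) (n - 2 - q) := by apply hi <;> omega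
    by_cases hc : m - 1 - a + q = u ∧ n - 2 - q = v
    · rw [← hc.1, ← hc.2]
      exact Or.inr (h.trans h1 h2)
    · have h3 : Q (m - 1 - a + q) (n - 2 - q) (m - a + q) (n - 2 - q) := by
        refine h.east (hBE _ _ ?_ ?_ ?_ ?_ ?_ ?_) ?_ ?_ ?_ ?_ ?_ ?_ <;> omega
      have h4 : Q (m - a + q) (n - 2 - q) (a - (q + 1)) (q + 1) := by apply ho <;> omega
      exact Or.inl ⟨by omega, h.trans h1 (h.trans h2 (h.trans h3 h4))⟩
  have high : ∀ t : ℕ, ∀ q, q + t = n - 1 → n - 1 - s ≤ q → η ≤ q → 0 ≤ q → q ≤ a →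
      Q (a - q) q u v := by
    intro t
    induction t with
    | zero =>
      intro q h₁ h₂ h₃ h₄ h₅
      exact h.refl (by omega) (by omega)
    | succ t ih =>
      intro q h₁ h₂ h₃ h₄ h₅
      push_cast at h₁
      rcases up q h₂ h₃ h₄ (by omega) h₅ with ⟨h₆, h₇⟩ | h₆
      · exact h.trans h₇ (ih (q + 1) (by omega) (by omega) (by omega) (by omega) h₆)
      · exact h₆
  have mid : ∀ q, η ≤ q → 0 ≤ q → q < n - 1 - s → Q (a - q) q (a - (n - 2 - s - q)) (n - 2 - s - q) :=
        fun q h₁ h₂ h₃ => by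
    have h1 : Q (a - q) q (a - q) (q + 1) := by
      refine h.north (hAN _ _ ?_ ?_ ?_ ?_ ?_) ?_ ?_ ?_ ?_ ?_ ?_ <;> omega
    have h2 : Q (a - q) (q + 1) (a - q + e) (q + 1 + s) := by apply hi <;> omega
    have h3 : Q (a - q + e) (q + 1 + s) (a - q + e + 1) (q + 1 + s) := by
      refine h.east (hBE _ _ ?_ ?_ ?_ ?_ ?_ ?_) ?_ ?_ ?_ ?_ ?_ ?_ <;> omega
    have h4 : Q (a - q + e + 1) (q + 1 + s) (a - (n - 2 - s - q)) (n - 2 - s - q) := by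
      apply ho <;> omega
    exact h.trans h1 (h.trans h2 (h.trans h3 h4))
  have low : ∀ q, 0 ≤ q → q < η → Q (a - q) q u v ∨
      (n - 1 - s - q ≤ a ∧ Q (a - q) q (a - (n - 1 - s - q)) (n - 1 - s - q)) :=
        fun q h₁ h₂ => by
    have h1 : Q (a - q) q (a - q + 1) q := by
      refine h.east (hAE _ _ ?_ ?_ ?_ ?_ ?_) ?_ ?_ ?_ ?_ ?_ ?_ <;> omega
    have h2 : Q (a - q + 1) q (a - q + 1 + e) (q + s) := by apply hi <;> omega
    by_cases hc : a - q + 1 + e = u ∧ q + s = v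
    · rw [← hc.1, ← hc.2]
      exact Or.inl (h.trans h1 h2)
    · have h3 : Q (a - q + 1 + e) (q + s) (a - q + e + 2) (q + s) := by
        refine h.east (hBE _ _ ?_ ?_ ?_ ?_ ?_ ?_) ?_ ?_ ?_ ?_ ?_ ?_ <;> omega
      have h4 : Q (a - q + e + 2) (q + s) (a - (n - 1 - s - q)) (n - 1 - s - q) := by
        apply ho <;> omega
      exact Or.inr ⟨by omega, h.trans h1 (h.trans h2 (h.trans h3 h4))⟩
  have lows : ∀ t : ℕ, t < η → Q (a - t) t u v := by
    intro t
    induction t with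
    | zero =>
      intro h₁
      simp only [Nat.cast_zero, sub_zero] at *
      rcases low 0 le_rfl h₁ with h₂ | ⟨h₂, h₃⟩
      · simpa using h₂
      · simp only [sub_zero] at h₂ h₃
        exact h.trans h₃ (high s.toNat _ (by omega) le_rfl (by omega) (by omega) h₂)
    | succ t ih =>
      intro h₁
      push_cast at *
      rcases low (t + 1) (by omega) h₁ with h₂ | ⟨h₂, h₃⟩
      · exact h₂
      · refine h.trans h₃ (h.trans (mid _ (by omega) (by omega) (by omega)) ?_)
        convert ih (by omega) using 1 <;> ring
  have lows' : ∀ q, 0 ≤ q → q < η → Q (a - q) q u v := fun q h₁ h₂ => by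
    have := lows q.toNat (by omega)
    rwa [show (q.toNat : ℤ) = q by omega] at this
  rcases lt_or_ge q η with hc | hc
  · exact lows' q hq0 hc
  · rcases lt_or_ge q (n - 1 - s) with hd | hd
    · exact h.trans (mid q hc hq0 hd) (lows' _ (by omega) (by omega))
    · exact high (n - 1 - q).toNat q (by omega) hd hc hq0 hqa

/-- As for the lower diagonal, the two reflections lower the row to 0, which is sent to n - 2 - s.
That row passes through the top of the paired diagonal, wraps north, and either ends or joins the
climbing rows. -/
theorem Route.reach_of_upper (h : Route m n E N Q) {e s η : ℤ} (hn : 3 ≤ n) (ha : 0 ≤ a)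
    (ham : a + 2 ≤ m) (he : 0 ≤ e) (hs : 0 ≤ s)
    (hes : e + s = m + n - 4 - 2 * a) (hx : n ≤ a + 2 + s)
    (ho : OuterFlow m n Q a) (hi : InnerFlow m n Q a e s) (hηn : η < n)
    (hη : n + s ≤ 2 * η) (hη' : 2 * η ≤ n + s + 1)
    (huv : (n ≤ a + 1 ∧ u = a - n + 1 ∧ v = n - 1) ∨ (a + 2 ≤ n ∧ u = m - 1 ∧ v = n - 2 - a))
    (hAN : ∀ p q, 0 ≤ p → 0 ≤ q → q + 1 < n → p + q = a → N p q)
    (hBE : ∀ p q, 0 ≤ p → p < m → 0 ≤ q → q < n → q < η → p + q = m + n - 3 - a →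
      (p = u → q ≠ v) → E p q)
    (hBN : ∀ p q, 0 ≤ p → p < m → 0 ≤ q → q < n → η ≤ q → p + q = m + n - 3 - a → N p q)
    (q : ℤ) (hq0 : 0 ≤ q) (hqn : q < n) (hqa : q ≤ a) : Q (a - q) q u v := by
  have north : ∀ q, 0 ≤ q → q + 1 < n → q ≤ a → Q (a - q) q (a - q) (q + 1) := fun q h₁ h₂ h₃ => by
    refine h.north (hAN _ _ ?_ ?_ ?_ ?_) ?_ ?_ ?_ ?_ ?_ ?_ <;> omega
  have up : ∀ q, n - 1 - s ≤ q → 0 ≤ q → q + 1 < n → q ≤ a →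
      (q + 1 ≤ a ∧ Q (a - q) q (a - (q + 1)) (q + 1)) ∨ Q (a - q) q u v :=
        fun q h₁ h₃ h₄ h₅ => by
    have h1 := north q h₃ h₄ h₅
    have h2 : Q (a - q) (q + 1) (m - 1 - a + q) (n - 2 - q) := by apply hi <;> omega
    by_cases hc : m - 1 - a + q = u ∧ n - 2 - q = v
    · rw [← hc.1, ← hc.2]
      exact Or.inr (h.trans h1 h2)
    · have h3 : Q (m - 1 - a + q) (n - 2 - q) (m - a + q) (n - 2 - q) := by
        refine h.east (hBE _ _ ?_ ?_ ?_ ?_ ?_ ?_ ?_) ?_ ?_ ?_ ?_ ?_ ?_ <;> omega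
      have h4 : Q (m - a + q) (n - 2 - q) (a - (q + 1)) (q + 1) := by apply ho <;> omega
      exact Or.inl ⟨by omega, h.trans h1 (h.trans h2 (h.trans h3 h4))⟩
  have high : ∀ t : ℕ, ∀ q, q + t = n - 1 → n - 1 - s ≤ q → 0 ≤ q → q ≤ a →
      Q (a - q) q u v := by
    intro t
    induction t with
    | zero =>
      intro q h₁ h₂ h₄ h₅
      exact h.refl (by omega) (by omega)
    | succ t ih =>
      intro q h₁ h₂ h₄ h₅
      push_cast at h₁
      rcases up q h₂ h₄ (by omega) h₅ with ⟨h₆, h₇⟩ | h₆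
      · exact h.trans h₇ (ih (q + 1) (by omega) (by omega) (by omega) h₆)
      · exact h₆
  -- This row is translated exactly to the top row, from which the step north wraps to (a + 1, 0).
  have exit : Q (a - (n - 2 - s)) (n - 2 - s) u v := by
    have h1 := north (n - 2 - s) (by omega) (by omega) (by omega)
    have h2 : Q (a - (n - 2 - s)) (n - 2 - s + 1) (m - 2 - a) (n - 1) := by apply hi <;> omega
    have h3 : Q (m - 2 - a) (n - 1) (a + 1) 0 := by
      refine h.northWrap (hBN _ _ ?_ ?_ ?_ ?_ ?_ ?_) ?_ ?_ ?_ ?_ ?_ <;> omega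
    have h4 : Q (a + 1) 0 (a + 1 + e) s := by apply hi <;> omega
    have h5 := h.trans h1 (h.trans h2 (h.trans h3 h4))
    by_cases hc : a + 1 + e = u ∧ s = v
    · rwa [← hc.1, ← hc.2]
    · have h6 : Q (a + 1 + e) s (a + 2 + e) s := by
        refine h.east (hBE _ _ ?_ ?_ ?_ ?_ ?_ ?_ ?_) ?_ ?_ ?_ ?_ ?_ ?_ <;> omega
      have h7 : Q (a + 2 + e) s (a - (n - 1 - s)) (n - 1 - s) := by apply ho <;> omega
      exact h.trans h5 (h.trans h6 (h.trans h7 (high s.toNat _ (by omega) le_rfl (by omega)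
        (by omega))))
  have mid : ∀ q, η - 1 - s ≤ q → q < n - 2 - s →
      Q (a - q) q (a - (n - 3 - s - q)) (n - 3 - s - q) := fun q h₁ h₃ => by
    have h1 := north q (by omega) (by omega) (by omega)
    have h2 : Q (a - q) (q + 1) (a - q + e) (q + 1 + s) := by apply hi <;> omega
    have h3 : Q (a - q + e) (q + 1 + s) (a - q + e) (q + 2 + s) := by
      refine h.north (hBN _ _ ?_ ?_ ?_ ?_ ?_ ?_) ?_ ?_ ?_ ?_ ?_ ?_ <;> omega
    have h4 : Q (a - q + e) (q + 2 + s) (a - (n - 3 - s - q)) (n - 3 - s - q) := by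
      apply ho <;> omega
    exact h.trans h1 (h.trans h2 (h.trans h3 h4))
  have low : ∀ q, 0 ≤ q → q < η - 1 - s → Q (a - q) q (a - (n - 2 - s - q)) (n - 2 - s - q) :=
        fun q h₁ h₂ => by
    have h1 := north q h₁ (by omega) (by omega)
    have h2 : Q (a - q) (q + 1) (a - q + e) (q + 1 + s) := by apply hi <;> omega
    have h3 : Q (a - q + e) (q + 1 + s) (a - q + e + 1) (q + 1 + s) := by
      refine h.east (hBE _ _ ?_ ?_ ?_ ?_ ?_ ?_ ?_) ?_ ?_ ?_ ?_ ?_ ?_ <;> omega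
    have h4 : Q (a - q + e + 1) (q + 1 + s) (a - (n - 2 - s - q)) (n - 2 - s - q) := by
      apply ho <;> omega
    exact h.trans h1 (h.trans h2 (h.trans h3 h4))
  have lows : ∀ t : ℕ, t < η - 1 - s → Q (a - t) t u v := by
    intro t
    induction t with
    | zero =>
      intro h₁
      have h₂ := low 0 le_rfl (by simpa using h₁)
      simp only [sub_zero] at h₂
      simpa using h.trans (by simpa using h₂) exit
    | succ t ih =>
      intro h₁
      push_cast at *
      refine h.trans (low (t + 1) (by omega) h₁) (h.trans (mid _ (by omega) (by omega)) ?_)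
      convert ih (by omega) using 1 <;> ring
  have lows' : ∀ q, 0 ≤ q → q < η - 1 - s → Q (a - q) q u v := fun q h₁ h₂ => by
    have := lows q.toNat (by omega)
    rwa [show (q.toNat : ℤ) = q by omega] at this
  rcases lt_trichotomy q (n - 2 - s) with hc | hc | hc
  · rcases lt_or_ge q (η - 1 - s) with hd | hd
    · exact lows' q hq0 hd
    · exact h.trans (mid q hd hc) (lows' _ (by omega) (by omega))
  · rw [hc]
    exact exit
  · exact high (n - 1 - q).toNat q (by omega) (by omega) hq0 hqa

/-- Rows of at least n - 1 - s descend one at a time to n - 2 - s. Below that, two reflections raise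
a row q < j by one, so all rows meet at j, the middle of the reflected rows. -/
theorem Route.reach_of_left (h : Route m n E N Q) {e s j : ℤ} (hn : 3 ≤ n)
    (ham : a + 2 ≤ m) (han : a + 2 ≤ n) (haj : n - 2 ≤ 2 * a) (he : 0 ≤ e)
    (hes : e + s = m + n - 4 - 2 * a) (hs : s = 2 * (n - 2 - a)) (hj : j = (n - 2 - s) / 2)
    (ho : OuterFlow m n Q a) (hi : InnerFlow m n Q a e s)
    (hAE : ∀ p q, 0 ≤ p → 0 ≤ q → q < n → j < q → p + q = a → E p q)
    (hAN : ∀ p q, 0 ≤ p → 0 ≤ q → q < j → p + q = a → N p q)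
    (hBN : ∀ p q, 0 ≤ p → p < m → 0 ≤ q → q < n → p + q = m + n - 3 - a → N p q)
    (q : ℤ) (hq0 : 0 ≤ q) (hqa : q ≤ a) : Q (a - q) q (a - j) j := by
  have east : ∀ q, j < q → q ≤ a → Q (a - q) q (a - q + 1) q := fun q h₁ h₂ => by
    refine h.east (hAE _ _ ?_ ?_ ?_ ?_ ?_) ?_ ?_ ?_ ?_ ?_ ?_ <;> omega
  have mid : ∀ q, j < q → q ≤ n - 2 - s → Q (a - q) q (a - (n - 2 - s - q)) (n - 2 - s - q) :=
      fun q h₁ h₂ => by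
    have h1 := east q h₁ (by omega)
    have h2 : Q (a - q + 1) q (a - q + 1 + e) (q + s) := by apply hi <;> omega
    have h3 : Q (a - q + 1 + e) (q + s) (a - q + 1 + e) (q + s + 1) := by
      refine h.north (hBN _ _ ?_ ?_ ?_ ?_ ?_) ?_ ?_ ?_ ?_ ?_ ?_ <;> omega
    have h4 : Q (a - q + 1 + e) (q + s + 1) (a - (n - 2 - s - q)) (n - 2 - s - q) := by
      apply ho <;> omega
    exact h.trans h1 (h.trans h2 (h.trans h3 h4))
  have low : ∀ q, 0 ≤ q → q < j → Q (a - q) q (a - (n - 3 - s - q)) (n - 3 - s - q) :=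
      fun q h₁ h₂ => by
    have h1 : Q (a - q) q (a - q) (q + 1) := by
      refine h.north (hAN _ _ ?_ ?_ ?_ ?_) ?_ ?_ ?_ ?_ ?_ ?_ <;> omega
    have h2 : Q (a - q) (q + 1) (a - q + e) (q + 1 + s) := by apply hi <;> omega
    have h3 : Q (a - q + e) (q + 1 + s) (a - q + e) (q + 2 + s) := by
      refine h.north (hBN _ _ ?_ ?_ ?_ ?_ ?_) ?_ ?_ ?_ ?_ ?_ ?_ <;> omega
    have h4 : Q (a - q + e) (q + 2 + s) (a - (n - 3 - s - q)) (n - 3 - s - q) := by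
      apply ho <;> omega
    exact h.trans h1 (h.trans h2 (h.trans h3 h4))
  have lows : ∀ t : ℕ, t ≤ j → Q (a - (j - t)) (j - t) (a - j) j := by
    intro t
    induction t with
    | zero => intro _; exact h.refl (by simp) (by simp)
    | succ t ih =>
      intro h₁
      push_cast at *
      refine h.trans (low _ (by omega) (by omega)) ?_
      by_cases hc : n - 3 - s - (j - (t + 1)) = j
      · exact h.refl (by omega) hc
      · refine h.trans (mid _ (by omega) (by omega)) ?_
        convert ih (by omega) using 1 <;> ring
  have lows' : ∀ q, 0 ≤ q → q ≤ j → Q (a - q) q (a - j) j := fun q h₁ h₂ => by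
    have := lows (j - q).toNat (by omega)
    rwa [show j - ((j - q).toNat : ℤ) = q by omega] at this
  have mids : ∀ q, 0 ≤ q → q ≤ n - 2 - s → Q (a - q) q (a - j) j := fun q h₁ h₂ => by
    rcases le_or_gt q j with hc | hc
    · exact lows' q h₁ hc
    · exact h.trans (mid q hc h₂) (lows' _ (by omega) (by omega))
  have highs : ∀ t : ℕ, n - 1 - s + t ≤ a → Q (a - (n - 1 - s + t)) (n - 1 - s + t) (a - j) j := by
    intro t
    induction t with
    | zero =>
      intro h₁
      simp only [Nat.cast_zero, add_zero] at *
      have h1 := east (n - 1 - s) (by omega) (by omega)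
      have h2 : Q (a - (n - 1 - s) + 1) (n - 1 - s) (m - 2 - a) (n - 1) := by apply hi <;> omega
      have h3 : Q (m - 2 - a) (n - 1) (a + 1) 0 := by
        refine h.northWrap (hBN _ _ ?_ ?_ ?_ ?_ ?_) ?_ ?_ ?_ ?_ ?_ <;> omega
      have h4 : Q (a + 1) 0 (a + 1 + e) s := by apply hi <;> omega
      have h5 : Q (a + 1 + e) s (a + 1 + e) (s + 1) := by
        refine h.north (hBN _ _ ?_ ?_ ?_ ?_ ?_) ?_ ?_ ?_ ?_ ?_ ?_ <;> omega
      have h6 : Q (a + 1 + e) (s + 1) (a - (n - 2 - s)) (n - 2 - s) := by apply ho <;> omega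
      exact h.trans h1 (h.trans h2 (h.trans h3 (h.trans h4 (h.trans h5 (h.trans h6
        (mids _ (by omega) le_rfl))))))
    | succ t ih =>
      intro h₁
      push_cast at *
      have h1 := east (n - 1 - s + (t + 1)) (by omega) h₁
      have h2 : Q (a - (n - 1 - s + (t + 1)) + 1) (n - 1 - s + (t + 1))
          (m - 1 - a + (n - 2 - s + (t + 1))) (s - (t + 1)) := by apply hi <;> omega
      have h3 : Q (m - 1 - a + (n - 2 - s + (t + 1))) (s - (t + 1))
          (m - 1 - a + (n - 2 - s + (t + 1))) (s - t) := by
        refine h.north (hBN _ _ ?_ ?_ ?_ ?_ ?_) ?_ ?_ ?_ ?_ ?_ ?_ <;> omega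
      have h4 : Q (m - 1 - a + (n - 2 - s + (t + 1))) (s - t) (a - (n - 1 - s + t))
          (n - 1 - s + t) := by apply ho <;> omega
      exact h.trans h1 (h.trans h2 (h.trans h3 (h.trans h4 (ih (by omega)))))
  rcases le_or_gt q (n - 2 - s) with hc | hc
  · exact mids q hq0 hc
  · have := highs (q - (n - 1 - s)).toNat (by omega)
    rwa [show n - 1 - s + ((q - (n - 1 - s)).toNat : ℤ) = q by omega] at this

end Reach

/-! ### Sufficiency: patterns with a zone of north diagonals. -/

section Zones

variable {m n : ℕ} {ι : Square m n}

/-- The k diagonals after `a` and their partners travel north, so s = 2k; if the zone contains the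
self-paired diagonal, that one counts once and s = 2k - 1. The bounds on the row are those of
`row_of_lower`. -/
theorem exists_path_of_lower (hn : 3 ≤ n) (hnm : n ≤ m) {a k s : ℤ}
    (ha : 0 ≤ a) (hab : 2 * a < m + n - 3) (hk0 : 0 ≤ k) (hk : n ≤ a + k + 2)
    (hs : 2 * k ≤ m + n - 4 - 2 * a ∧ s = 2 * k ∨
      2 * k = m + n - 3 - 2 * a ∧ s = m + n - 4 - 2 * a)
    (hsn : s ≤ n)
    (hι : ((ι.1 : ℕ) : ℤ) + (ι.2 : ℕ) = a + 1) (hη : (n : ℤ) - s - 1 ≤ 2 * (ι.2 : ℕ))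
    (hη' : 2 * ((ι.2 : ℕ) : ℤ) ≤ n - s) :
    ∃ l : List (Square m n), IsHamiltonianPath (board m n) l ∧ l.head? = some ι := by
  have hι₁ := ι.1.isLt
  have hι₂ := ι.2.isLt
  obtain ⟨η, hη₀⟩ : ∃ η : ℤ, η = (ι.2 : ℕ) := ⟨_, rfl⟩
  obtain ⟨u, v, huv⟩ : ∃ u v : ℤ, (n ≤ a + 1 ∧ u = a - n + 1 ∧ v = n - 1) ∨
      (a + 2 ≤ n ∧ u = m - 1 ∧ v = n - 2 - a) := by
    rcases le_or_gt (n : ℤ) (a + 1) with hc | hc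
    · exact ⟨_, _, Or.inl ⟨hc, rfl, rfl⟩⟩
    · exact ⟨_, _, Or.inr ⟨by omega, rfl, rfl⟩⟩
  refine Pattern.exists_hamiltonianPath (u := u) (v := v)
    (N := fun p q => a < p + q ∧ p + q ≤ a + k ∨
      m + n - 3 - a - k ≤ p + q ∧ p + q < m + n - 3 - a ∨ p + q = a ∧ η ≤ q ∧ q + 1 < n)
    (E := fun p q => ¬ (a < p + q ∧ p + q ≤ a + k) ∧
      ¬ (m + n - 3 - a - k ≤ p + q ∧ p + q < m + n - 3 - a) ∧
      ¬ (p + q = a ∧ η ≤ q ∧ q + 1 < n) ∧ (p = u → q ≠ v))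
    ⟨?_, ?_, ?_, ?_, ?_, ?_, ?_, ?_, ?_, ?_⟩ (by omega) (by omega) (by omega) (by omega) ?_
  any_goals intros; omega
  intro Q h
  have hO : ∀ p q : ℤ, 0 ≤ p → p < m → 0 ≤ q → q < n → (p + q < a ∨ m + n - 3 - a < p + q) →
      ¬ (a < p + q ∧ p + q ≤ a + k) ∧
      ¬ (m + n - 3 - a - k ≤ p + q ∧ p + q < m + n - 3 - a) ∧
      ¬ (p + q = a ∧ η ≤ q ∧ q + 1 < n) ∧ (p = u → q ≠ v) := by
    intros; omega
  obtain ⟨e, hes, he, ho, hi, hx⟩ := h.flows (a := a) (k := k) (s := s) (by omega) (by omega) ha hab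
    hk hk0 hs hsn hO (by intros; omega) (by intros; omega)
  have hA := h.reach_of_lower (η := η) (u := u) (v := v) (by omega) ha (by omega) he (by omega) hsn
    hes (by omega) ho hi (by omega) (by omega) (by omega) (by omega) huv (by intros; omega)
    (by intros; omega) (by intros; omega)
  refine h.reach_of_diagonals (a := a) (by omega) hO hA ?_ hx
  intro p q h₁ h₂ h₃ h₄ h₅
  by_cases hc : p = u ∧ q = v
  · exact h.refl hc.1 hc.2
  · refine h.trans (h.east (p' := p + 1) (q' := q) ?_ h₁ ?_ h₃ h₄ rfl rfl) ?_
    · omega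
    · omega
    · exact h.outer_reach (a := a) (by omega) hO hA (by omega) (by omega) h₃ h₄ (by omega)

theorem exists_path_of_upper (hn : 3 ≤ n) (hnm : n ≤ m) {a k s : ℤ}
    (ha : 0 ≤ a) (hab : 2 * a < m + n - 3) (hk0 : 0 ≤ k) (hk : n ≤ a + k + 2)
    (hs : 2 * k ≤ m + n - 4 - 2 * a ∧ s = 2 * k ∨
      2 * k = m + n - 3 - 2 * a ∧ s = m + n - 4 - 2 * a)
    (hsn : s ≤ n)
    (hι : ((ι.1 : ℕ) : ℤ) + (ι.2 : ℕ) = m + n - 2 - a) (hη : (n : ℤ) + s ≤ 2 * (ι.2 : ℕ))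
    (hη' : 2 * ((ι.2 : ℕ) : ℤ) ≤ n + s + 1) :
    ∃ l : List (Square m n), IsHamiltonianPath (board m n) l ∧ l.head? = some ι := by
  have hι₁ := ι.1.isLt
  have hι₂ := ι.2.isLt
  obtain ⟨η, hη₀⟩ : ∃ η : ℤ, η = (ι.2 : ℕ) := ⟨_, rfl⟩
  obtain ⟨u, v, huv⟩ : ∃ u v : ℤ, (n ≤ a + 1 ∧ u = a - n + 1 ∧ v = n - 1) ∨
      (a + 2 ≤ n ∧ u = m - 1 ∧ v = n - 2 - a) := by
    rcases le_or_gt (n : ℤ) (a + 1) with hc | hc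
    · exact ⟨_, _, Or.inl ⟨hc, rfl, rfl⟩⟩
    · exact ⟨_, _, Or.inr ⟨by omega, rfl, rfl⟩⟩
  refine Pattern.exists_hamiltonianPath (u := u) (v := v)
    (N := fun p q => a < p + q ∧ p + q ≤ a + k ∨
      m + n - 3 - a - k ≤ p + q ∧ p + q < m + n - 3 - a ∨ p + q = a ∧ q + 1 < n ∨
      p + q = m + n - 3 - a ∧ η ≤ q)
    (E := fun p q => ¬ (a < p + q ∧ p + q ≤ a + k) ∧
      ¬ (m + n - 3 - a - k ≤ p + q ∧ p + q < m + n - 3 - a) ∧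
      ¬ (p + q = a ∧ q + 1 < n) ∧ ¬ (p + q = m + n - 3 - a ∧ η ≤ q) ∧ (p = u → q ≠ v))
    ⟨?_, ?_, ?_, ?_, ?_, ?_, ?_, ?_, ?_, ?_⟩ (by omega) (by omega) (by omega) (by omega) ?_
  any_goals intros; omega
  intro Q h
  have hO : ∀ p q : ℤ, 0 ≤ p → p < m → 0 ≤ q → q < n → (p + q < a ∨ m + n - 3 - a < p + q) →
      ¬ (a < p + q ∧ p + q ≤ a + k) ∧
      ¬ (m + n - 3 - a - k ≤ p + q ∧ p + q < m + n - 3 - a) ∧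
      ¬ (p + q = a ∧ q + 1 < n) ∧ ¬ (p + q = m + n - 3 - a ∧ η ≤ q) ∧ (p = u → q ≠ v) := by
    intros; omega
  obtain ⟨e, hes, he, ho, hi, hx⟩ := h.flows (a := a) (k := k) (s := s) (by omega) (by omega) ha hab
    hk hk0 hs hsn hO (by intros; omega) (by intros; omega)
  have hA := h.reach_of_upper (η := η) (u := u) (v := v) (by omega) ha (by omega) he (by omega)
    hes (by omega) ho hi (by omega) (by omega) (by omega) huv (by intros; omega)
    (by intros; omega) (by intros; omega)
  have hout : ∀ p q : ℤ, 0 ≤ p → p < m → 0 ≤ q → q < n → m + n - 3 - a < p + q → Q p q u v :=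
    fun p q h₁ h₂ h₃ h₄ h₅ => h.outer_reach (a := a) (by omega) hO hA h₁ h₂ h₃ h₄ (by omega)
  refine h.reach_of_diagonals (a := a) (by omega) hO hA ?_ hx
  have below : ∀ p q : ℤ, 0 ≤ p → p < m → 0 ≤ q → q < η → p + q = m + n - 3 - a → Q p q u v := by
    intro p q h₁ h₂ h₃ h₄ h₅
    by_cases hc : p = u ∧ q = v
    · exact h.refl hc.1 hc.2
    · refine h.trans (h.east (p' := p + 1) (q' := q) ?_ h₁ ?_ h₃ ?_ rfl rfl)
        (hout _ _ ?_ ?_ ?_ ?_ ?_) <;> omega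
  intro p q h₁ h₂ h₃ h₄ h₅
  rcases lt_or_ge q η with hc | hc
  · exact below p q h₁ h₂ h₃ hc h₅
  by_cases hq : q + 1 = n
  · refine h.trans (h.northWrap (p' := a + 1) (q' := 0) ?_ h₁ h₂ hq ?_ rfl) ?_
    · omega
    · omega
    · refine h.trans (hi (a + 1) 0 (a + 1 + e) s ?_ ?_ ?_ ?_ ?_ ?_) (below _ _ ?_ ?_ ?_ ?_ ?_) <;>
        omega
  · refine h.trans (h.north (p' := p) (q' := q + 1) ?_ h₁ h₂ h₃ ?_ rfl rfl)
      (hout _ _ ?_ ?_ ?_ ?_ ?_) <;> omega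

theorem exists_path_of_left (hn : 3 ≤ n) (hnm : n ≤ m) (hp : (ι.1 : ℕ) = 0)
    (hq : (n - 1) / 2 < (ι.2 : ℕ)) :
    ∃ l : List (Square m n), IsHamiltonianPath (board m n) l ∧ l.head? = some ι := by
  have hι₁ := ι.1.isLt
  have hι₂ := ι.2.isLt
  obtain ⟨a, ha⟩ : ∃ a : ℤ, a = (ι.2 : ℕ) - 1 := ⟨_, rfl⟩
  -- All diagonals from a + 1 to n - 2 travel north, a zone of n - 2 - a pairs; s is twice that
  -- number.
  obtain ⟨s, hs⟩ : ∃ s : ℤ, s = 2 * (n - 2 - a) := ⟨_, rfl⟩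
  obtain ⟨j, hj⟩ : ∃ j : ℤ, j = (n - 2 - s) / 2 := ⟨_, rfl⟩
  refine Pattern.exists_hamiltonianPath (u := a - j) (v := j)
    (N := fun p q => a < p + q ∧ p + q ≤ n - 2 ∨
      m - 1 ≤ p + q ∧ p + q ≤ m + n - 3 - a ∨ p + q = a ∧ q < j)
    (E := fun p q => ¬ (a < p + q ∧ p + q ≤ n - 2) ∧
      ¬ (m - 1 ≤ p + q ∧ p + q ≤ m + n - 3 - a) ∧ ¬ (p + q = a ∧ q ≤ j))
    ⟨?_, ?_, ?_, ?_, ?_, ?_, ?_, ?_, ?_, ?_⟩ (by omega) (by omega) (by omega) (by omega) ?_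
  any_goals intros; omega
  intro Q h
  have hO : ∀ p q : ℤ, 0 ≤ p → p < m → 0 ≤ q → q < n → (p + q < a ∨ m + n - 3 - a < p + q) →
      ¬ (a < p + q ∧ p + q ≤ n - 2) ∧
      ¬ (m - 1 ≤ p + q ∧ p + q ≤ m + n - 3 - a) ∧ ¬ (p + q = a ∧ q ≤ j) := by
    intros; omega
  obtain ⟨e, hes, he, ho, hi, hx⟩ := h.flows (a := a) (k := n - 2 - a) (s := s) (by omega)
    (by omega) (by omega) (by omega) (by omega) (by omega) (by omega) (by omega) hO
    (by intros; omega) (by intros; omega)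
  have hA := h.reach_of_left (j := j) (by omega) (by omega) (by omega) (by omega) he
    hes hs hj ho hi (by intros; omega) (by intros; omega) (by intros; omega)
  have hout : ∀ p q : ℤ, 0 ≤ p → p < m → 0 ≤ q → q < n → m + n - 3 - a < p + q →
      Q p q (a - j) j :=
    fun p q h₁ h₂ h₃ h₄ h₅ => h.outer_reach (a := a) (by omega) hO (fun q g₁ _ g₂ => hA q g₁ g₂)
      h₁ h₂ h₃ h₄ (by omega)
  refine h.reach_of_diagonals (a := a) (by omega) hO (fun q g₁ _ g₂ => hA q g₁ g₂) ?_ hx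
  have below : ∀ p q : ℤ, 0 ≤ p → p < m → 0 ≤ q → q + 1 < n → p + q = m + n - 3 - a →
      Q p q (a - j) j := by
    intro p q h₁ h₂ h₃ h₄ h₅
    refine h.trans (h.north (p' := p) (q' := q + 1) ?_ h₁ h₂ h₃ h₄ rfl rfl)
      (hout _ _ ?_ ?_ ?_ ?_ ?_) <;> omega
  intro p q h₁ h₂ h₃ h₄ h₅
  by_cases hq : q + 1 = n
  · refine h.trans (h.northWrap (p' := a + 1) (q' := 0) ?_ h₁ h₂ hq ?_ rfl) ?_
    · omega
    · omega
    · refine h.trans (hi (a + 1) 0 (a + 1 + e) s ?_ ?_ ?_ ?_ ?_ ?_) (below _ _ ?_ ?_ ?_ ?_ ?_) <;>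
        omega
  · exact below p q h₁ h₂ h₃ (by omega) h₅

/-- Paths starting in the block of squares in the lower middle of the board. -/
theorem exists_path_of_block {m n : ℕ} {ι : Square m n} (hn : 3 ≤ n)
    (hnm : n ≤ m) (hp : (n - 1) / 2 ≤ (ι.1 : ℕ)) (hpm : (ι.1 : ℕ) ≤ (m - 1) / 2)
    (hq : (ι.2 : ℕ) ≤ n / 2) :
    ∃ l : List (Square m n), IsHamiltonianPath (board m n) l ∧ l.head? = some ι := by
  by_cases hc : (ι.2 : ℕ) = n / 2 ∧ n ≤ (ι.1 : ℕ) + n / 2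
  · exact exists_path_of_upper_middle hn hc.2 hc.1
  · obtain ⟨a, ha⟩ : ∃ a : ℤ, a = (ι.1 : ℕ) + (ι.2 : ℕ) - 1 := ⟨_, rfl⟩
    -- This width makes the given row one of the two values that a lower initial square may take.
    obtain ⟨k, hk⟩ : ∃ k : ℤ, k = n / 2 - (ι.2 : ℕ) := ⟨_, rfl⟩
    rcases le_or_gt (2 * k) (m + n - 4 - 2 * a) with hs | hs
    · refine exists_path_of_lower (a := a) (k := k) (s := 2 * k) hn hnm ?_ ?_ ?_ ?_ ?_ ?_ ?_ ?_ ?_ <;>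
        omega
    · refine exists_path_of_lower (a := a) (k := k) (s := m + n - 4 - 2 * a) hn hnm ?_ ?_ ?_ ?_ ?_
        ?_ ?_ ?_ ?_ <;> omega

end Zones

end ProjectiveCheckerboard

theorem mainTheorem1 (m n : ℕ) (hn : 3 ≤ n) (hmn : n ≤ m) (p : Fin m) (q : Fin n) :
    (∃ l : List (ProjectiveCheckerboard.Square m n),
        ProjectiveCheckerboard.IsHamiltonianPath (ProjectiveCheckerboard.board m n) l ∧
          l.head? = some (p, q)) ↔
      (((p : ℕ) = 0 ∧ (n - 1) / 2 ≤ (q : ℕ) ∧ (q : ℕ) ≤ n - 1) ∨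
        ((n - 1) / 2 ≤ (p : ℕ) ∧ (p : ℕ) ≤ m - 1 ∧ (q : ℕ) = 0) ∨
        ((m + 1) / 2 ≤ (p : ℕ) ∧ (p : ℕ) ≤ m - 1 ∧ (q : ℕ) = n / 2) ∨
        (0 ≤ (p : ℕ) ∧ (p : ℕ) ≤ n / 2 ∧ (q : ℕ) = (n - 1) / 2) ∨
        (m / 2 ≤ (p : ℕ) ∧ (p : ℕ) ≤ m - (n + 1) / 2 ∧ n / 2 + 1 ≤ (q : ℕ) ∧ (q : ℕ) ≤ n - 1) ∨
        ((n - 1) / 2 ≤ (p : ℕ) ∧ (p : ℕ) ≤ (m - 1) / 2 ∧ 0 ≤ (q : ℕ) ∧ (q : ℕ) ≤ n / 2)) := by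
  have hp := p.isLt
  have hq := q.isLt
  constructor
  · rintro ⟨l, hl, hι⟩
    have := (hl.coveringRoute hι (by omega) (by omega)).initial_mem (by omega) (by omega)
      (by omega) (by omega) (by omega) (by omega)
    simp only at this
    rcases this with h | h | h | h | h | h
    · left; omega
    · right; left; omega
    · right; right; left; omega
    · right; right; right; left; omega
    · right; right; right; right; left; omega
    · right; right; right; right; right; omega
  · intro h
    have block := ProjectiveCheckerboard.exists_path_of_block (ι := (p, q)) hn hmn
    have middle := ProjectiveCheckerboard.exists_path_of_lower_middle (ι := (p, q)) hn hmn
    rcases h with h | h | h | h | h | h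
    -- The end row (n - 1) / 2 is not covered by the left-column pattern but belongs to the fourth
    -- region.
    · rcases h.2.1.eq_or_lt with hc | hc
      · exact middle (by simp only; omega) hc.symm
      · exact ProjectiveCheckerboard.exists_path_of_left hn hmn h.1 hc
    · rcases h.1.eq_or_lt with hc | hc
      · exact block h.1 (by simp only; omega) (by simp only; omega)
      · exact ProjectiveCheckerboard.exists_path_of_bottom hn hc h.2.2
    · exact ProjectiveCheckerboard.exists_path_of_upper_middle hn (by simp only; omega) h.2.2
    · exact middle h.2.1 h.2.2
    · clear block middle
      obtain ⟨a, ha⟩ : ∃ a : ℤ, a = m + n - 2 - (p : ℕ) - (q : ℕ) := ⟨_, rfl⟩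
      -- The width is solved from n + s ≤ 2q ≤ n + s + 1 with s = 2k, or s = 2k - 1 when the zone
      -- reaches the self-paired diagonal.
      obtain ⟨k, hk⟩ : ∃ k : ℤ, k = (q : ℕ) - ((n + 1) / 2 : ℕ) := ⟨_, rfl⟩
      have hk0 : 0 ≤ k := by omega
      have hk1 : (n : ℤ) ≤ a + k + 2 := by omega
      rcases le_or_gt (2 * k) (m + n - 4 - 2 * a) with hs | hs
      · refine ProjectiveCheckerboard.exists_path_of_upper (ι := (p, q)) (a := a) (k := k)
          (s := 2 * k) hn hmn ?_ ?_ hk0 hk1 ?_ ?_ ?_ ?_ ?_ <;>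
          first | omega | (simp only; omega)
      · refine ProjectiveCheckerboard.exists_path_of_upper (ι := (p, q)) (a := a) (k := k)
          (s := m + n - 4 - 2 * a) hn hmn ?_ ?_ hk0 hk1 ?_ ?_ ?_ ?_ ?_ <;>
          first | omega | (simp only; omega)
    · exact block h.1 h.2.1 h.2.2.2
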